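/- For each $n\in\mathbb N$ let $a^{(n)}=(a^{(n)}_i)_{i\in\mathbb Z}$ be a real sequence, not identically zero, with $\sum_{i\in\mathbb Z}|a^{(n)}_i|<\infty$. Let $(X_i)_{i\in\mathbb Z}$ be i.i.d. random variables with $\mathbb P(X_i=1)=\mathbb P(X_i=-1)=\tfrac12$, put $\xi_i=(X_i+1)/2$ and $$G_n=\sum_{i\in\mathbb Z}a^{(n)}_i\,\xi_i\xi_{i+1},\qquad F_n=\frac{G_n-\mathbb E[G_n]}{\sqrt{\operatorname{Var}(G_n)}},\qquad C_n=\frac{\|a^{(n)}\|_{\ell^4(\mathbb Z)}^2}{\operatorname{Var}(G_n)},$$ where $\|a\|_{\ell^4(\mathbb Z)}=\bigl(\sum_{i\in\mathbb Z}|a_i|^4\bigr)^{1/4}$. Let $\Phi$ be the standard normal distribution function. Then there are constants $K,c>0$, depending only on the family of coefficient sequences $(a^{(n)})_{n\in\mathbb N}$ (in particular not on $n$ or $z$), such that, with $$\gamma_n(z)=e^{c\,z\operatorname{Var}(G_n)^{-1/2}}\Bigl(z^{1/2}C_n^{1/2}+(1+z^{1/2}+z)\,C_n\Bigr),$$ one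 has $$\left|\frac{\mathbb P(F_n>z)}{1-\Phi(z)}-1\right|\le K\,(1+z^2)\,\gamma_n(z)$$ for all $n\in\mathbb N$ and all $z$ with $0\le z\le\min\{C_n^{-1/5},C_n^{-1/3},C_n^{-2/5},\operatorname{Var}(G_n)^{1/2}\}$ and $(1+z^2)\gamma_n(z)\le 1$. -/

import Mathlib

open MeasureTheory ProbabilityTheory

namespace TwoRuns

/-- `X = (X_i)_{i ∈ ℤ}` is a two-sided sequence of independent symmetric Rademacher random
variables under `μ`. -/
structure IsRademacherSequence {Ω : Type*} [MeasurableSpace Ω] (μ : Measure Ω)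
    (X : ℤ → Ω → ℝ) : Prop where
  measurable : ∀ i, Measurable (X i)
  indep : iIndepFun X μ
  prob_one : ∀ i, μ {ω | X i ω = 1} = 1 / 2
  prob_neg_one : ∀ i, μ {ω | X i ω = -1} = 1 / 2

/-- The Bernoulli variable `ξ_i = (X_i + 1) / 2`. -/
noncomputable def xi {Ω : Type*} (X : ℤ → Ω → ℝ) (i : ℤ) (ω : Ω) : ℝ := (X i ω + 1) / 2

/-- The infinite weighted 2-run `G = ∑_{i ∈ ℤ} a_i ξ_i ξ_{i+1}`. For summable `a` the series
converges absolutely wherever all `X_i` take values in `{1, -1}`, hence almost surely. -/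
noncomputable def G {Ω : Type*} (X : ℤ → Ω → ℝ) (a : ℤ → ℝ) (ω : Ω) : ℝ :=
  ∑' i : ℤ, a i * xi X i ω * xi X (i + 1) ω

/-- The standardized 2-run `F = (G - 𝔼[G]) / √Var(G)`. -/
noncomputable def F {Ω : Type*} [MeasurableSpace Ω] (μ : Measure Ω) (X : ℤ → Ω → ℝ)
    (a : ℤ → ℝ) (ω : Ω) : ℝ :=
  (G X a ω - ∫ ω', G X a ω' ∂μ) / Real.sqrt (variance (G X a) μ)

/-- The `ℓ^p(ℤ)` norm `(∑_{i ∈ ℤ} |a_i|^p)^{1/p}`. -/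
noncomputable def lpNorm (p : ℝ) (a : ℤ → ℝ) : ℝ := (∑' i : ℤ, |a i| ^ p) ^ (1 / p)

/-- `C = ‖a‖²_{ℓ⁴(ℤ)} / Var(G)`. -/
noncomputable def C {Ω : Type*} [MeasurableSpace Ω] (μ : Measure Ω) (X : ℤ → Ω → ℝ)
    (a : ℤ → ℝ) : ℝ :=
  lpNorm 4 a ^ 2 / variance (G X a) μ

/-- `γ(z) = e^{c z Var(G)^{-1/2}} (z^{1/2} C^{1/2} + (1 + z^{1/2} + z) C)`, where `c` is the
constant in the exponent. -/
noncomputable def gamma {Ω : Type*} [MeasurableSpace Ω] (μ : Measure Ω) (X : ℤ → Ω → ℝ)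
    (a : ℤ → ℝ) (c z : ℝ) : ℝ :=
  Real.exp (c * z * variance (G X a) μ ^ (-(1 / 2) : ℝ)) *
    (z ^ (1 / 2 : ℝ) * C μ X a ^ (1 / 2 : ℝ) + (1 + z ^ (1 / 2 : ℝ) + z) * C μ X a)

/-- The upper end `min {C^{-1/5}, C^{-1/3}, C^{-2/5}, Var(G)^{1/2}}` of the range of `z`. -/
noncomputable def range {Ω : Type*} [MeasurableSpace Ω] (μ : Measure Ω) (X : ℤ → Ω → ℝ)
    (a : ℤ → ℝ) : ℝ :=
  min (min (C μ X a ^ (-(1 / 5) : ℝ)) (C μ X a ^ (-(1 / 3) : ℝ)))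
    (min (C μ X a ^ (-(2 / 5) : ℝ)) (variance (G X a) μ ^ (1 / 2 : ℝ)))

/-- The standard normal distribution function `Φ`. -/
noncomputable def Phi (z : ℝ) : ℝ := cdf (gaussianReal 0 1) z

end TwoRuns

/-!
The proof is Stein's method on the discrete cube, sharpened by exponential tilting.

Flipping one sign preserves the law of a Rademacher sequence, which gives an integration by parts
formula (`TwoRuns.integral_tsum_sgn_mul`): a series `V = ∑ x_k w_k`, with `w_k` independent of the
sign `x_k`, satisfies `E[V h] = E[∑ w_k D_k h]`, where `D_k` is the discrete derivative. After
rescaling, the standardized 2-run is `W = ∑ x_k u_k` with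
`u_k = α_{k-1} + α_k + α_k x_{k+1}`. Put `d_k = D_k W` and `κ = ‖α‖₄²`, so that `κ = C / 16`.

Let `f` solve the Stein equation `f'(s) - s f(s) = 1_{s ≤ z} - Φ(z)`. Integration by parts turns
`E[W f(W)]` into `E[∑ u_k D_k f(W)]`. Since `f'` is, up to a constant, the difference of the
increasing functions `s f(s)` and `1_{s > z}`, the error in the chain rule
`D_k f(W) ≈ d_k f'(W)` is at most `2 d_k D_k g(W)`, where `g` is the sum of these two functions.
This bound is again a discrete derivative, so a second integration by parts gives
(`TwoRuns.abs_tail_sub_le`)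
`|P(W > z) - (1 - Φ(z))| ≤ E[|f'(W)| |T - 1|] + 2 E[|g(W)| |Y|]`,
where `T = ∑ u_k d_k` and `Y = ∑ x_k |u_k| d_k`. No concentration inequality is needed.

Both `T - 1` (`TwoRuns.steinKer_eq`) and `Y` are divergences with local weights quadratic in `α`.
Integration by parts under the tilt `e^{tW}` bounds their first absolute moments by
`O((1 + t) κ) E[e^{tW}]` (`TwoRuns.integral_abs_mul_exp_le`), and the same computation gives a
differential inequality for the moment generating function, whence `E[e^{tW}] = O(e^{t²/2})` as
long as `κ ≤ 1` and `t³ κ ≤ 1` (`TwoRuns.IsNormalized.integral_exp_le`). Finally `|f'|` and `|g|`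
are bounded by a sum of exponentials with rates in `[0, z]` (`TwoRuns.stein_bounds`), which gives
an error `O((1 + z)³ κ)` relative to `1 - Φ(z)` (`TwoRuns.IsNormalized.abs_tail_sub_le`). This is
dominated by `(1 + z²) γ(z)`; the constants are universal, and the constraints `z ≤ C^{-1/3}` and
`(1 + z²) γ(z) ≤ 1` supply the conditions `z³ κ ≤ 1` and `κ ≤ 1`.
-/

namespace TwoRuns

/-! ### Integration by parts on the discrete cube -/

/-- The sample space of a two-sided sequence of signs; `true` encodes `+1`. -/
abbrev Cube : Type := ℤ → Bool

/-- The `k`-th sign `±1` of a point of the cube. -/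
def sgn (k : ℤ) (x : Cube) : ℝ := if x k then 1 else -1

/-- The involution of the cube that changes the `k`-th sign. -/
def flip (k : ℤ) (x : Cube) : Cube := Function.update x k (!x k)

/-- The discrete derivative `(h(x with x_k = 1) - h(x with x_k = -1)) / 2`, written through the
flip at `k`. -/
noncomputable def discDeriv (k : ℤ) (h : Cube → ℝ) (x : Cube) : ℝ :=
  sgn k x * (h x - h (flip k x)) / 2

/-- `P` is invariant under all flips; this characterizes the uniform measure on the cube. -/
def FlipInvariant (P : Measure Cube) : Prop := ∀ k, MeasurePreserving (flip k) P P

lemma sgn_sq (k : ℤ) (x : Cube) : sgn k x * sgn k x = 1 := by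
  unfold sgn; split_ifs <;> norm_num

lemma abs_sgn (k : ℤ) (x : Cube) : |sgn k x| = 1 := by
  unfold sgn; split_ifs <;> norm_num

@[simp] lemma sgn_flip_self (k : ℤ) (x : Cube) : sgn k (flip k x) = -sgn k x := by
  unfold sgn flip; cases x k <;> simp

lemma sgn_flip_of_ne {j k : ℤ} (h : j ≠ k) (x : Cube) : sgn j (flip k x) = sgn j x := by
  unfold sgn flip; simp [Function.update_of_ne h]

@[fun_prop] lemma measurable_sgn (k : ℤ) : Measurable (sgn k) :=
  (measurable_of_countable (fun b : Bool => if b then (1 : ℝ) else -1)).comp (measurable_pi_apply k)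

@[fun_prop] lemma measurable_flip (k : ℤ) : Measurable (flip k) := by
  refine measurable_pi_lambda _ fun j => ?_
  by_cases h : j = k
  · subst h
    simp only [flip, Function.update_self]
    exact (measurable_of_countable (fun b : Bool => !b)).comp (measurable_pi_apply j)
  · simpa [flip, Function.update_of_ne h] using measurable_pi_apply j

@[fun_prop] lemma measurable_discDeriv (k : ℤ) {h : Cube → ℝ} (hh : Measurable h) :
    Measurable (discDeriv k h) := by
  unfold discDeriv; fun_prop

lemma abs_discDeriv (k : ℤ) (h : Cube → ℝ) (x : Cube) :
    |discDeriv k h x| = |h x - h (flip k x)| / 2 := by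
  rw [discDeriv, abs_div, abs_mul, abs_sgn, one_mul, abs_two]

lemma abs_discDeriv_le (k : ℤ) {h : Cube → ℝ} {c : ℝ} (hc : ∀ x, |h x| ≤ c) (x : Cube) :
    |discDeriv k h x| ≤ c := by
  rw [abs_discDeriv]
  have h1 := hc x
  have h2 := hc (flip k x)
  have := abs_sub (h x) (h (flip k x))
  linarith

lemma measurable_tsum_of_le {f : ℤ → Cube → ℝ} {b : ℤ → ℝ} (hb : Summable b)
    (hf : ∀ k, Measurable (f k)) (hfb : ∀ k x, |f k x| ≤ b k) :
    Measurable fun x => ∑' k, f k x := by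
  refine measurable_of_tendsto_metrizable' (Filter.atTop : Filter (Finset ℤ))
    (f := fun s x => ∑ k ∈ s, f k x) (fun s => Finset.measurable_fun_sum s fun k _ => hf k) ?_
  rw [tendsto_pi_nhds]
  exact fun x => (Summable.of_norm_bounded hb fun k => hfb k x).hasSum

lemma summable_of_abs_le {f b : ℤ → ℝ} (hb : Summable b) (h : ∀ k, |f k| ≤ b k) : Summable f :=
  Summable.of_norm_bounded hb h

lemma abs_tsum_le {f b : ℤ → ℝ} (hb : Summable b) (h : ∀ k, |f k| ≤ b k) :
    |∑' k, f k| ≤ ∑' k, b k :=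
  tsum_of_norm_bounded (f := f) hb.hasSum h

section

variable {P : Measure Cube}

lemma integral_comp_flip (hP : FlipInvariant P) (k : ℤ) {h : Cube → ℝ} (hm : Measurable h) :
    ∫ x, h (flip k x) ∂P = ∫ x, h x ∂P := by
  have := integral_map (μ := P) (φ := flip k) (measurable_flip k).aemeasurable
    (f := h) hm.aestronglyMeasurable
  rw [(hP k).map_eq] at this
  exact this.symm

variable [IsProbabilityMeasure P]

lemma integrable_of_abs_le {h : Cube → ℝ} {c : ℝ} (hm : Measurable h) (hc : ∀ x, |h x| ≤ c) :
    Integrable h P :=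
  Integrable.of_bound hm.aestronglyMeasurable c (ae_of_all _ hc)

lemma integral_sgn_mul (hP : FlipInvariant P) (k : ℤ) {w h : Cube → ℝ} {b c : ℝ}
    (hwm : Measurable w) (hw : ∀ x, |w x| ≤ b) (hinv : ∀ x, w (flip k x) = w x)
    (hm : Measurable h) (hc : ∀ x, |h x| ≤ c) :
    ∫ x, sgn k x * w x * h x ∂P = ∫ x, w x * discDeriv k h x ∂P := by
  have e := integral_comp_flip hP k (h := fun x => sgn k x * w x * h x) (by fun_prop)
  have hi : ∀ g : Cube → ℝ, Measurable g → (∀ x, |g x| ≤ c) →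
      Integrable (fun x => sgn k x * w x * g x) P := by
    intro g hg hgc
    refine integrable_of_abs_le (c := b * c) (by fun_prop) fun x => ?_
    rw [abs_mul, abs_mul, abs_sgn, one_mul]
    exact mul_le_mul (hw x) (hgc x) (abs_nonneg _) ((abs_nonneg _).trans (hw x))
  have h1 := hi h hm hc
  have h2 := hi (fun x => h (flip k x)) (by fun_prop) fun x => hc _
  simp only [sgn_flip_self, hinv] at e
  have e3 : ∫ x, w x * discDeriv k h x ∂P =
      (∫ x, sgn k x * w x * h x ∂P - ∫ x, sgn k x * w x * h (flip k x) ∂P) / 2 := by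
    rw [← integral_sub h1 h2, ← integral_div]
    congr 1; ext x; unfold discDeriv; ring
  have e4 : ∫ x, -sgn k x * w x * h (flip k x) ∂P = -∫ x, sgn k x * w x * h (flip k x) ∂P := by
    rw [← integral_neg]; congr 1; ext x; ring
  rw [e3]; linarith

lemma integrable_tsum_mul_discDeriv {w : ℤ → Cube → ℝ} {b : ℤ → ℝ}
    (hb : Summable b) (hwm : ∀ k, Measurable (w k)) (hw : ∀ k x, |w k x| ≤ b k)
    {h : Cube → ℝ} {c : ℝ} (hm : Measurable h) (hc : ∀ x, |h x| ≤ c) :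
    Integrable (fun x => ∑' k, w k x * discDeriv k h x) P := by
  have hk : ∀ k x, |w k x * discDeriv k h x| ≤ b k * c := fun k x => by
    rw [abs_mul]
    exact mul_le_mul (hw k x) (abs_discDeriv_le k hc x) (abs_nonneg _)
      ((abs_nonneg _).trans (hw k x))
  exact integrable_of_abs_le
    (measurable_tsum_of_le (hb.mul_right c) (fun k => by have := hwm k; fun_prop) hk)
    fun x => abs_tsum_le (hb.mul_right c) fun k => hk k x

/-- Integration by parts: a series `∑ x_k w_k`, whose `k`-th weight does not see the `k`-th sign, is
the discrete divergence of `w`, and the divergence is adjoint to the discrete gradient. -/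
lemma integral_tsum_sgn_mul (hP : FlipInvariant P) {w : ℤ → Cube → ℝ} {b : ℤ → ℝ}
    (hb : Summable b) (hwm : ∀ k, Measurable (w k)) (hw : ∀ k x, |w k x| ≤ b k)
    (hinv : ∀ k x, w k (flip k x) = w k x)
    {h : Cube → ℝ} {c : ℝ} (hm : Measurable h) (hc : ∀ x, |h x| ≤ c) :
    ∫ x, (∑' k, sgn k x * w k x) * h x ∂P = ∫ x, ∑' k, w k x * discDeriv k h x ∂P := by
  have l1 : ∀ k x, |sgn k x * w k x * h x| ≤ b k * c := fun k x => by
    rw [abs_mul, abs_mul, abs_sgn, one_mul]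
    exact mul_le_mul (hw k x) (hc x) (abs_nonneg _) ((abs_nonneg _).trans (hw k x))
  have l2 : ∀ k x, |w k x * discDeriv k h x| ≤ b k * c := fun k x => by
    rw [abs_mul]
    exact mul_le_mul (hw k x) (abs_discDeriv_le k hc x) (abs_nonneg _)
      ((abs_nonneg _).trans (hw k x))
  have key : ∀ f : ℤ → Cube → ℝ, (∀ k, Measurable (f k)) → (∀ k x, |f k x| ≤ b k * c) →
      ∫ x, ∑' k, f k x ∂P = ∑' k, ∫ x, f k x ∂P := by
    intro f hf hfb
    refine (integral_tsum_of_summable_integral_norm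
      (fun k => integrable_of_abs_le (hf k) (hfb k)) ?_).symm
    refine Summable.of_nonneg_of_le (fun k => integral_nonneg fun x => norm_nonneg _) (fun k => ?_)
      (hb.mul_right c)
    have := integral_mono (μ := P) (integrable_of_abs_le (hf k) (hfb k)).norm
      (integrable_const (b k * c)) fun x => hfb k x
    simpa using this
  simp_rw [← tsum_mul_right]
  rw [key _ (fun k => by have := hwm k; fun_prop) l1, key _ (fun k => by have := hwm k; fun_prop) l2]
  exact tsum_congr fun k => integral_sgn_mul hP k (hwm k) (hw k) (hinv k) hm hc

end

/-! ### The Gaussian tail and the Mills ratio -/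

open Filter Topology in
lemma nonneg_of_antitoneOn_tendsto {r : ℝ → ℝ} {b x : ℝ} (h : AntitoneOn r (Set.Ioi b))
    (hr : Tendsto r atTop (𝓝 0)) (hx : b < x) : 0 ≤ r x := by
  refine le_of_tendsto hr ?_
  filter_upwards [eventually_ge_atTop x] with y hy
  exact h hx (hx.trans_le hy) hy

lemma gaussianPDFReal_std (s : ℝ) :
    gaussianPDFReal 0 1 s = (√(2 * Real.pi))⁻¹ * Real.exp (-s ^ 2 / 2) := by
  simp [gaussianPDFReal]

lemma Phi_eq_integral (s : ℝ) : Phi s = ∫ x in Set.Iic s, gaussianPDFReal 0 1 x := by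
  rw [Phi, cdf_eq_real, Measure.real, gaussianReal_apply_eq_integral 0 one_ne_zero,
    ENNReal.toReal_ofReal]
  exact setIntegral_nonneg measurableSet_Iic fun x _ => gaussianPDFReal_nonneg 0 1 x

lemma hasDerivAt_Phi (s : ℝ) :
    HasDerivAt Phi ((√(2 * Real.pi))⁻¹ * Real.exp (-s ^ 2 / 2)) s := by
  have hc : Continuous (gaussianPDFReal 0 1) := by
    have : gaussianPDFReal 0 1 = fun s => (√(2 * Real.pi))⁻¹ * Real.exp (-s ^ 2 / 2) :=
      funext gaussianPDFReal_std
    rw [this]; fun_prop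
  have h1 : Phi = fun s => Phi 0 + ∫ x in (0 : ℝ)..s, gaussianPDFReal 0 1 x := by
    ext t
    have hi : ∀ b, IntegrableOn (gaussianPDFReal 0 1) (Set.Iic b) := fun b =>
      (integrable_gaussianPDFReal 0 1).integrableOn
    rw [← intervalIntegral.integral_Iic_sub_Iic (hi 0) (hi t), Phi_eq_integral, Phi_eq_integral]
    ring
  rw [h1, ← gaussianPDFReal_std]
  exact (intervalIntegral.integral_hasDerivAt_right (hc.intervalIntegrable _ _)
    (hc.stronglyMeasurableAtFilter _ _) hc.continuousAt).const_add _

lemma Phi_neg (s : ℝ) : Phi (-s) = 1 - Phi s := by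
  have hd : ∀ t, HasDerivAt (fun t => Phi (-t) + Phi t) 0 t := fun t => by
    have h := ((hasDerivAt_Phi (-t)).scomp t (hasDerivAt_neg t)).add (hasDerivAt_Phi t)
    refine h.congr_deriv ?_
    simp
  have hconst : ∀ t, Phi (-t) + Phi t = Phi (-0) + Phi 0 := fun t =>
    is_const_of_deriv_eq_zero (fun t => (hd t).differentiableAt) (fun t => (hd t).deriv) t 0
  have h1 : Filter.Tendsto (fun t => Phi (-t) + Phi t) Filter.atTop (nhds (0 + 1)) :=
    ((tendsto_cdf_atBot _).comp Filter.tendsto_neg_atTop_atBot).add (tendsto_cdf_atTop _)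
  have h2 : Filter.Tendsto (fun t => Phi (-t) + Phi t) Filter.atTop
      (nhds (Phi (-0) + Phi 0)) := by
    rw [funext hconst]; exact tendsto_const_nhds
  have := tendsto_nhds_unique h1 h2
  linarith [hconst s]

lemma Phi_nonneg (s : ℝ) : 0 ≤ Phi s := cdf_nonneg _ _

lemma Phi_le_one (s : ℝ) : Phi s ≤ 1 := cdf_le_one _ _

lemma tendsto_one_sub_Phi : Filter.Tendsto (fun s => 1 - Phi s) Filter.atTop (nhds 0) := by
  have h := (tendsto_cdf_atTop (gaussianReal 0 1)).const_sub 1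
  rw [sub_self] at h
  exact h

/-- The Mills ratio `(1 - Φ(s)) / φ(s)` of the standard normal distribution. -/
noncomputable def mills (s : ℝ) : ℝ := √(2 * Real.pi) * Real.exp (s ^ 2 / 2) * (1 - Phi s)

lemma sqrt_two_pi_pos : 0 < √(2 * Real.pi) := Real.sqrt_pos.2 (by positivity)

lemma mills_nonneg (s : ℝ) : 0 ≤ mills s := by
  have := Phi_le_one s
  unfold mills
  have : 0 ≤ 1 - Phi s := by linarith
  positivity

lemma one_sub_Phi_eq (s : ℝ) :
    1 - Phi s = (√(2 * Real.pi))⁻¹ * Real.exp (-s ^ 2 / 2) * mills s := by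
  have h := sqrt_two_pi_pos.ne'
  have : Real.exp (-s ^ 2 / 2) * Real.exp (s ^ 2 / 2) = 1 := by
    rw [← Real.exp_add]; simp [neg_div]
  unfold mills
  calc 1 - Phi s = ((√(2 * Real.pi))⁻¹ * √(2 * Real.pi)) *
        (Real.exp (-s ^ 2 / 2) * Real.exp (s ^ 2 / 2)) * (1 - Phi s) := by
          rw [this, inv_mul_cancel₀ h]; ring
    _ = _ := by ring

lemma hasDerivAt_exp_sq (s : ℝ) :
    HasDerivAt (fun s : ℝ => Real.exp (s ^ 2 / 2)) (s * Real.exp (s ^ 2 / 2)) s := by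
  have h := (((hasDerivAt_id s).pow 2).div_const 2).exp
  refine h.congr_deriv ?_
  simp; ring

lemma hasDerivAt_exp_neg_sq (s : ℝ) :
    HasDerivAt (fun s : ℝ => Real.exp (-s ^ 2 / 2)) (-s * Real.exp (-s ^ 2 / 2)) s := by
  have h := ((((hasDerivAt_id s).pow 2).neg).div_const 2).exp
  refine h.congr_deriv ?_
  simp; ring

lemma hasDerivAt_mills (s : ℝ) : HasDerivAt mills (s * mills s - 1) s := by
  have h := ((hasDerivAt_exp_sq s).const_mul √(2 * Real.pi)).mul ((hasDerivAt_Phi s).const_sub 1)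
  refine h.congr_deriv ?_
  have h0 := sqrt_two_pi_pos.ne'
  have : Real.exp (s ^ 2 / 2) * Real.exp (-s ^ 2 / 2) = 1 := by
    rw [← Real.exp_add]; simp [neg_div]
  have h2 : √(2 * Real.pi) * Real.exp (s ^ 2 / 2) *
      -((√(2 * Real.pi))⁻¹ * Real.exp (-s ^ 2 / 2)) = -1 := by
    calc _ = -((√(2 * Real.pi) * (√(2 * Real.pi))⁻¹) *
        (Real.exp (s ^ 2 / 2) * Real.exp (-s ^ 2 / 2))) := by ring
      _ = -1 := by rw [this, mul_inv_cancel₀ h0]; ring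
  rw [h2]; unfold mills; ring

lemma exp_neg_sq_le_one (s : ℝ) : Real.exp (-s ^ 2 / 2) ≤ 1 :=
  Real.exp_le_one_iff.2 (by nlinarith [sq_nonneg s])

open Filter Topology in
/-- The upper Mills bound: `φ(s)/s - (1 - Φ(s))` decreases to `0`. -/
lemma mul_mills_le_one (s : ℝ) : s * mills s ≤ 1 := by
  rcases le_or_gt s 0 with hs | hs
  · nlinarith [mills_nonneg s]
  set c := (√(2 * Real.pi))⁻¹ with hc
  have hc0 : 0 < c := inv_pos.2 sqrt_two_pi_pos
  have hd : ∀ x : ℝ, 0 < x → HasDerivAt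
      (fun x => c * Real.exp (-x ^ 2 / 2) * x⁻¹ - (1 - Phi x))
      (-(c * Real.exp (-x ^ 2 / 2) / x ^ 2)) x := fun x hx => by
    have h := ((((hasDerivAt_exp_neg_sq x).const_mul c).mul (hasDerivAt_inv hx.ne')).sub
      ((hasDerivAt_Phi x).const_sub 1))
    refine h.congr_deriv ?_
    rw [← hc]; field_simp; ring
  have hanti : AntitoneOn (fun x => c * Real.exp (-x ^ 2 / 2) * x⁻¹ - (1 - Phi x))
      (Set.Ioi 0) := by
    refine antitoneOn_of_deriv_nonpos (convex_Ioi 0)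
      (fun x hx => (hd x hx).continuousAt.continuousWithinAt)
      (fun x hx => (hd x (by simpa using hx)).differentiableAt.differentiableWithinAt)
      fun x hx => ?_
    have hx : 0 < x := by simpa using hx
    rw [(hd x hx).deriv]
    have : 0 ≤ c * Real.exp (-x ^ 2 / 2) / x ^ 2 := by positivity
    linarith
  have hlim : Tendsto (fun x => c * Real.exp (-x ^ 2 / 2) * x⁻¹ - (1 - Phi x)) atTop (𝓝 0) := by
    have h1 : Tendsto (fun x : ℝ => c * Real.exp (-x ^ 2 / 2) * x⁻¹) atTop (𝓝 0) := by
      refine squeeze_zero' (g := fun x : ℝ => c * x⁻¹) ?_ ?_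
        (by simpa using tendsto_inv_atTop_zero.const_mul c)
      · filter_upwards [eventually_gt_atTop 0] with x hx
        positivity
      · filter_upwards [eventually_gt_atTop 0] with x hx
        have := mul_le_mul_of_nonneg_left (exp_neg_sq_le_one x) hc0.le
        have hx' : 0 ≤ x⁻¹ := by positivity
        nlinarith
    simpa using h1.sub tendsto_one_sub_Phi
  have h := nonneg_of_antitoneOn_tendsto hanti hlim hs
  simp only [one_sub_Phi_eq s, ← hc] at h
  have hp : 0 < c * Real.exp (-s ^ 2 / 2) := by positivity
  have h2 : 0 ≤ c * Real.exp (-s ^ 2 / 2) * (s⁻¹ - mills s) := by linarith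
  have h3 := (mul_nonneg_iff_of_pos_left hp).1 h2
  have h4 := mul_nonneg hs.le h3
  rw [mul_sub, mul_inv_cancel₀ hs.ne'] at h4
  linarith

open Filter Topology in
/-- The lower Mills bound: `(1 - Φ(s)) - s φ(s)/(1 + s²)` decreases to `0`. -/
lemma le_one_add_sq_mul_mills (s : ℝ) : s ≤ (1 + s ^ 2) * mills s := by
  rcases le_or_gt s 0 with hs | hs
  · have := mills_nonneg s
    have : 0 ≤ (1 + s ^ 2) * mills s := by positivity
    linarith
  set c := (√(2 * Real.pi))⁻¹ with hc
  have hc0 : 0 < c := inv_pos.2 sqrt_two_pi_pos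
  have hd : ∀ x : ℝ, HasDerivAt
      (fun x => (1 - Phi x) - c * Real.exp (-x ^ 2 / 2) * (x / (1 + x ^ 2)))
      (-(2 * c * Real.exp (-x ^ 2 / 2) / (1 + x ^ 2) ^ 2)) x := fun x => by
    have hx : 1 + x ^ 2 ≠ 0 := by positivity
    have h := (((hasDerivAt_Phi x).const_sub 1)).sub
      (((hasDerivAt_exp_neg_sq x).const_mul c).mul
        ((hasDerivAt_id x).div (((hasDerivAt_id x).pow 2).const_add 1) hx))
    refine h.congr_deriv ?_
    rw [← hc]; simp only [Pi.pow_apply, Pi.div_apply, id]; field_simp; push_cast; ring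
  have hanti : AntitoneOn
      (fun x => (1 - Phi x) - c * Real.exp (-x ^ 2 / 2) * (x / (1 + x ^ 2))) (Set.Ioi 0) := by
    refine (antitone_of_deriv_nonpos (fun x => (hd x).differentiableAt) fun x => ?_).antitoneOn _
    rw [(hd x).deriv]
    have : 0 ≤ 2 * c * Real.exp (-x ^ 2 / 2) / (1 + x ^ 2) ^ 2 := by positivity
    linarith
  have hlim : Tendsto
      (fun x => (1 - Phi x) - c * Real.exp (-x ^ 2 / 2) * (x / (1 + x ^ 2))) atTop (𝓝 0) := by
    have h1 : Tendsto (fun x : ℝ => c * Real.exp (-x ^ 2 / 2) * (x / (1 + x ^ 2))) atTop (𝓝 0) := by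
      refine squeeze_zero' (g := fun x : ℝ => c * x⁻¹) ?_ ?_
        (by simpa using tendsto_inv_atTop_zero.const_mul c)
      · filter_upwards [eventually_gt_atTop 0] with x hx
        positivity
      · filter_upwards [eventually_gt_atTop 0] with x hx
        have h1 := mul_le_mul_of_nonneg_left (exp_neg_sq_le_one x) hc0.le
        have h2 : x / (1 + x ^ 2) ≤ x⁻¹ := by
          rw [div_le_iff₀ (by positivity)]; field_simp; nlinarith
        rw [mul_one] at h1
        exact mul_le_mul h1 h2 (by positivity) hc0.le
    simpa using tendsto_one_sub_Phi.sub h1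
  have h := nonneg_of_antitoneOn_tendsto hanti hlim hs
  simp only [one_sub_Phi_eq s, ← hc] at h
  have hp : 0 < c * Real.exp (-s ^ 2 / 2) := by positivity
  have h2 : 0 ≤ c * Real.exp (-s ^ 2 / 2) * (mills s - s / (1 + s ^ 2)) := by linarith
  have h3 := (mul_nonneg_iff_of_pos_left hp).1 h2
  have h4 : s / (1 + s ^ 2) ≤ mills s := by linarith
  rw [div_le_iff₀ (by positivity)] at h4
  linarith

lemma mills_antitone : Antitone mills := by
  refine antitone_of_deriv_nonpos (fun x => (hasDerivAt_mills x).differentiableAt) fun x => ?_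
  rw [(hasDerivAt_mills x).deriv]
  linarith [mul_mills_le_one x]

/-- `s * mills s` is increasing: its derivative is `(1 + s²) mills s - s ≥ 0`. -/
lemma monotone_mul_mills : Monotone fun s => s * mills s := by
  have hd : ∀ x, HasDerivAt (fun s => s * mills s) ((1 + x ^ 2) * mills x - x) x := fun x => by
    refine ((hasDerivAt_id x).mul (hasDerivAt_mills x)).congr_deriv ?_
    simp only [id]; ring
  refine monotone_of_deriv_nonneg (fun x => (hd x).differentiableAt) fun x => ?_
  rw [(hd x).deriv]
  linarith [le_one_add_sq_mul_mills x]

lemma inv_le_mills {z : ℝ} (hz : 0 ≤ z) : 1 ≤ 2 * (1 + z) * mills z := by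
  have h1 : 1 / 2 ≤ mills 1 := by
    have := le_one_add_sq_mul_mills 1; linarith
  rcases le_or_gt z 1 with h | h
  · have := mills_antitone h
    nlinarith
  · have h2 := le_one_add_sq_mul_mills z
    have h3 : (1 + z ^ 2) * mills z ≤ z * (2 * (1 + z) * mills z) := by
      have := mills_nonneg z
      nlinarith [mul_nonneg this (sq_nonneg z), mul_nonneg this hz]
    have h4 : z * 1 ≤ z * (2 * (1 + z) * mills z) := by linarith
    exact le_of_mul_le_mul_left h4 (by linarith)

/-- The Gaussian tail is at least of order `φ(z) / (1 + z)`. -/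
lemma exp_le_one_sub_Phi {z : ℝ} (hz : 0 ≤ z) :
    Real.exp (-z ^ 2 / 2) ≤ 2 * √(2 * Real.pi) * (1 + z) * (1 - Phi z) := by
  have h := inv_le_mills hz
  have h0 := sqrt_two_pi_pos
  rw [one_sub_Phi_eq]
  calc Real.exp (-z ^ 2 / 2) ≤ Real.exp (-z ^ 2 / 2) * (2 * (1 + z) * mills z) :=
        le_mul_of_one_le_right (Real.exp_pos _).le h
    _ = (√(2 * Real.pi) * (√(2 * Real.pi))⁻¹) *
        (Real.exp (-z ^ 2 / 2) * (2 * (1 + z) * mills z)) := by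
        rw [mul_inv_cancel₀ h0.ne', one_mul]
    _ = _ := by ring

lemma one_sub_Phi_pos (z : ℝ) (hz : 0 ≤ z) : 0 < 1 - Phi z := by
  have h := exp_le_one_sub_Phi hz
  have := Real.exp_pos (-z ^ 2 / 2)
  have h0 := sqrt_two_pi_pos
  exact pos_of_mul_pos_right (this.trans_le h) (by positivity)

/-! ### The Stein equation -/

/-- The bounded solution `f` of the Stein equation `f'(s) - s f(s) = 1_{s ≤ z} - Φ(z)`. -/
noncomputable def steinSol (z s : ℝ) : ℝ :=
  if s ≤ z then (1 - Phi z) * mills (-s) else Phi z * mills s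

/-- The derivative of the Stein solution `f`, with its value at the kink `s = z` chosen such that
the Stein equation holds everywhere. -/
noncomputable def steinDeriv (z s : ℝ) : ℝ :=
  s * steinSol z s + (if s ≤ z then 1 else 0) - Phi z

/-- The sum `s f(s) + 1_{s > z}` of the two increasing functions whose difference is, up to a
constant, the derivative of the Stein solution `f`. -/
noncomputable def steinMono (z s : ℝ) : ℝ :=
  s * steinSol z s + (if z < s then 1 else 0)

lemma mills_neg (s : ℝ) : mills (-s) = √(2 * Real.pi) * Real.exp (s ^ 2 / 2) * Phi s := by
  rw [mills, Phi_neg, neg_sq]; ring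

lemma continuous_mills : Continuous mills :=
  continuous_iff_continuousAt.2 fun s => (hasDerivAt_mills s).continuousAt

lemma continuous_steinSol (z : ℝ) : Continuous (steinSol z) := by
  refine Continuous.if_le (continuous_const.mul (continuous_mills.comp continuous_neg))
    (continuous_const.mul continuous_mills) continuous_id continuous_const fun s hs => ?_
  obtain rfl : s = z := hs
  rw [mills_neg, mills]; ring

lemma hasDerivAt_steinSol {z s : ℝ} (h : s ≠ z) :
    HasDerivAt (steinSol z) (steinDeriv z s) s := by
  rcases lt_or_gt_of_ne h with h | h
  · have h1 := ((hasDerivAt_mills (-s)).scomp s (hasDerivAt_neg s)).const_mul (1 - Phi z)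
    have h2 : HasDerivAt (steinSol z) _ s := h1.congr_of_eventuallyEq (by
      filter_upwards [eventually_lt_nhds h] with x hx
      simp [steinSol, hx.le])
    refine h2.congr_deriv ?_
    simp [steinDeriv, steinSol, h.le]; ring
  · have h1 := (hasDerivAt_mills s).const_mul (Phi z)
    have h2 : HasDerivAt (steinSol z) _ s := h1.congr_of_eventuallyEq (by
      filter_upwards [eventually_gt_nhds h] with x hx
      simp [steinSol, hx.not_ge])
    refine h2.congr_deriv ?_
    simp [steinDeriv, steinSol, h.not_ge]; ring

lemma monotone_mul_steinSol (z : ℝ) : Monotone fun s => s * steinSol z s := by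
  have hq : 0 ≤ 1 - Phi z := by linarith [Phi_le_one z]
  have hl : ∀ x y, x ≤ y → y ≤ z → x * steinSol z x ≤ y * steinSol z y := fun x y hxy hy => by
    have h := mul_le_mul_of_nonneg_left (monotone_mul_mills (neg_le_neg hxy)) hq
    simp only [steinSol, hy, hxy.trans hy, if_true] at *
    linarith
  have hval : z * steinSol z z = Phi z * (z * mills z) := by
    simp only [steinSol, le_refl, if_true]
    rw [mills_neg, mills]; ring
  have hr : ∀ x y, z ≤ x → x ≤ y → x * steinSol z x ≤ y * steinSol z y := fun x y hx hxy => by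
    have h := mul_le_mul_of_nonneg_left (monotone_mul_mills hxy) (Phi_nonneg z)
    have e : ∀ w, z ≤ w → w * steinSol z w = Phi z * (w * mills w) := fun w hw => by
      rcases hw.eq_or_lt with rfl | hw
      · exact hval
      · simp only [steinSol, hw.not_ge, if_false]; ring
    rw [e x hx, e y (hx.trans hxy)]
    exact h
  intro x y hxy
  rcases le_total y z with hy | hy
  · exact hl x y hxy hy
  · rcases le_total x z with hx | hx
    · exact (hl x z hx le_rfl).trans (hr z y le_rfl hy)
    · exact hr x y hx hxy

lemma monotone_indicator_gt (z : ℝ) : Monotone fun s : ℝ => if z < s then (1 : ℝ) else 0 := by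
  intro x y hxy
  dsimp only
  split_ifs with h1 h2 h2
  · exact le_rfl
  · exact absurd (h1.trans_le hxy) h2
  · norm_num
  · exact le_rfl

lemma steinDeriv_eq (z s : ℝ) :
    steinDeriv z s = s * steinSol z s - (if z < s then 1 else 0) + (1 - Phi z) := by
  unfold steinDeriv
  rcases le_or_gt s z with h | h
  · simp [h, h.not_gt]; ring
  · simp [h, h.not_ge]

/-- A mean value inequality that allows one exceptional point. -/
lemma sub_le_mul_sub_of_hasDerivAt_ne {f p : ℝ → ℝ} {z a b M : ℝ} (hf : Continuous f)
    (hd : ∀ s, s ≠ z → HasDerivAt f (p s) s) (hab : a ≤ b)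
    (hM : ∀ s ∈ Set.Icc a b, p s ≤ M) : f b - f a ≤ M * (b - a) := by
  have key : ∀ c d, a ≤ c → c ≤ d → d ≤ b → z ∉ Set.Ioo c d → f d - f c ≤ M * (d - c) := by
    intro c d hac hcd hdb hz
    have hne : ∀ s ∈ interior (Set.Icc c d), s ≠ z := by
      rintro s hs rfl
      rw [interior_Icc] at hs
      exact hz hs
    refine (convex_Icc c d).image_sub_le_mul_sub_of_deriv_le hf.continuousOn
      (fun s hs => (hd s (hne s hs)).differentiableAt.differentiableWithinAt) (fun s hs => ?_)
      c ⟨le_rfl, hcd⟩ d ⟨hcd, le_rfl⟩ hcd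
    rw [(hd s (hne s hs)).deriv]
    rw [interior_Icc] at hs
    exact hM s ⟨hac.trans hs.1.le, hs.2.le.trans hdb⟩
  by_cases hz : z ∈ Set.Ioo a b
  · have h1 := key a z le_rfl hz.1.le hz.2.le (fun h => lt_irrefl _ h.2)
    have h2 := key z b hz.1.le hz.2.le le_rfl (fun h => lt_irrefl _ h.1)
    linarith
  · exact key a b le_rfl hab le_rfl hz

/-- The first-order Taylor error of the Stein solution is dominated by an increment of the
monotone function `steinMono`. -/
lemma abs_steinSol_sub_le (z s t : ℝ) :
    |steinSol z s - steinSol z t - (s - t) * steinDeriv z s| ≤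
      (s - t) * (steinMono z s - steinMono z t) := by
  have key : ∀ a b r, a ≤ b → r ∈ Set.Icc a b →
      |steinSol z b - steinSol z a - (b - a) * steinDeriv z r| ≤
        (b - a) * (steinMono z b - steinMono z a) := by
    intro a b r hab hr
    have hup : ∀ x ∈ Set.Icc a b, steinDeriv z x ≤
        b * steinSol z b - (if z < a then 1 else 0) + (1 - Phi z) := fun x hx => by
      rw [steinDeriv_eq]
      have h1 := monotone_mul_steinSol z hx.2
      have h2 := monotone_indicator_gt z hx.1
      dsimp only at h1 h2
      linarith
    have hlo : ∀ x ∈ Set.Icc a b,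
        a * steinSol z a - (if z < b then 1 else 0) + (1 - Phi z) ≤ steinDeriv z x := fun x hx => by
      rw [steinDeriv_eq]
      have h1 := monotone_mul_steinSol z hx.1
      have h2 := monotone_indicator_gt z hx.2
      dsimp only at h1 h2
      linarith
    have h1 := sub_le_mul_sub_of_hasDerivAt_ne (continuous_steinSol z)
      (fun s hs => hasDerivAt_steinSol hs) hab hup
    have h2 := sub_le_mul_sub_of_hasDerivAt_ne (continuous_steinSol z).neg
      (fun s hs => (hasDerivAt_steinSol hs).neg) hab (fun x hx => neg_le_neg (hlo x hx))
    have h3 := mul_le_mul_of_nonneg_right (hup r hr) (sub_nonneg.2 hab)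
    have h4 := mul_le_mul_of_nonneg_right (hlo r hr) (sub_nonneg.2 hab)
    simp only [Pi.neg_apply] at h2
    unfold steinMono
    rw [abs_le]
    constructor <;> nlinarith
  rcases le_total t s with h | h
  · exact key t s s h ⟨h, le_rfl⟩
  · have := key s t s h ⟨le_rfl, h⟩
    rw [← abs_neg]
    convert this using 1
    · congr 1; ring
    · ring

/-- An exponential envelope for the derivative of the Stein solution and for `steinMono`. On
`[0, z]` both grow at most like `(1 - Φ(z)) s e^{s²/2}`, and the summand of index `⌊s⌋` majorizes
`s e^{s²/2}`. -/
noncomputable def steinEnv (z s : ℝ) : ℝ :=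
  (1 - Phi z) * (1 + √(2 * Real.pi) * ∑ j ∈ Finset.range (⌊z⌋₊ + 1),
    ((j : ℝ) + 1) * Real.exp (1 / 2 - (j : ℝ) ^ 2 / 2) * Real.exp (j * s)) +
  2 * Real.exp (-z ^ 2) * Real.exp (z * s)

lemma mul_exp_sq_le_sum {z s : ℝ} (hs : 0 ≤ s) (hsz : s ≤ z) :
    s * Real.exp (s ^ 2 / 2) ≤ ∑ j ∈ Finset.range (⌊z⌋₊ + 1),
      ((j : ℝ) + 1) * Real.exp (1 / 2 - (j : ℝ) ^ 2 / 2) * Real.exp (j * s) := by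
  have hmem : ⌊s⌋₊ ∈ Finset.range (⌊z⌋₊ + 1) :=
    Finset.mem_range.2 (Nat.lt_succ_of_le (Nat.floor_le_floor hsz))
  refine le_trans ?_ (Finset.single_le_sum (fun j _ => by positivity) hmem)
  have h1 := Nat.floor_le hs
  have h2 := Nat.lt_floor_add_one s
  rw [mul_assoc, ← Real.exp_add]
  refine mul_le_mul h2.le (Real.exp_le_exp.2 ?_) (Real.exp_pos _).le (by positivity)
  nlinarith

lemma stein_bounds {z : ℝ} (hz : 0 ≤ z) (s : ℝ) :
    |steinDeriv z s| ≤ steinEnv z s ∧ |steinMono z s| ≤ steinEnv z s := by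
  have hq := one_sub_Phi_pos z hz
  have hP := Phi_nonneg z
  have hpi := sqrt_two_pi_pos
  set S := ∑ j ∈ Finset.range (⌊z⌋₊ + 1),
    ((j : ℝ) + 1) * Real.exp (1 / 2 - (j : ℝ) ^ 2 / 2) * Real.exp (j * s) with hS
  have hS0 : 0 ≤ S := Finset.sum_nonneg fun j _ => by positivity
  have hE : 0 ≤ Real.exp (-z ^ 2) * Real.exp (z * s) := by positivity
  have henv : steinEnv z s = (1 - Phi z) + (1 - Phi z) * (√(2 * Real.pi) * S) +
      2 * (Real.exp (-z ^ 2) * Real.exp (z * s)) := by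
    rw [steinEnv, ← hS]; ring
  have hqS : 0 ≤ (1 - Phi z) * (√(2 * Real.pi) * S) := by positivity
  rw [henv]
  rcases le_or_gt s z with h | h
  · have hd : steinDeriv z s = s * steinSol z s + (1 - Phi z) := by
      rw [steinDeriv, if_pos h]; ring
    have hm : steinMono z s = s * steinSol z s := by
      rw [steinMono, if_neg h.not_gt, add_zero]
    have hg : s * steinSol z s = (1 - Phi z) * (s * mills (-s)) := by
      rw [steinSol, if_pos h]; ring
    rw [hd, hm]
    rcases lt_or_ge s 0 with h0 | h0
    · have h1 := mul_le_mul_of_nonneg_left (mul_mills_le_one (-s)) hq.le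
      have h2 : 0 ≤ (1 - Phi z) * (-s * mills (-s)) :=
        mul_nonneg hq.le (mul_nonneg (by linarith) (mills_nonneg _))
      have h3 : s * steinSol z s = -((1 - Phi z) * (-s * mills (-s))) := by rw [hg]; ring
      constructor <;> rw [abs_le] <;> constructor <;> linarith
    · have h1 : s * mills (-s) ≤ √(2 * Real.pi) * S := by
        rw [mills_neg]
        have ha := mul_exp_sq_le_sum h0 h
        have hb : s * Real.exp (s ^ 2 / 2) * Phi s ≤ s * Real.exp (s ^ 2 / 2) :=
          mul_le_of_le_one_right (by positivity) (Phi_le_one s)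
        have := mul_le_mul_of_nonneg_left (hb.trans ha) hpi.le
        linarith
      have h2 := mul_le_mul_of_nonneg_left h1 hq.le
      have h3 : 0 ≤ s * steinSol z s := by
        rw [hg]; exact mul_nonneg hq.le (mul_nonneg h0 (mills_nonneg _))
      rw [← hg] at h2
      constructor <;> rw [abs_le] <;> constructor <;> linarith
  · have hd : steinDeriv z s = s * steinSol z s - Phi z := by
      rw [steinDeriv, if_neg h.not_ge]; ring
    have hm : steinMono z s = s * steinSol z s + 1 := by
      rw [steinMono, if_pos h]
    have hg : s * steinSol z s = Phi z * (s * mills s) := by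
      rw [steinSol, if_neg h.not_ge]; ring
    have h1 := mul_le_mul_of_nonneg_left (mul_mills_le_one s) hP
    have h2 : 0 ≤ s * steinSol z s := by
      rw [hg]; exact mul_nonneg hP (mul_nonneg (by linarith) (mills_nonneg _))
    have h3 : 1 ≤ Real.exp (-z ^ 2) * Real.exp (z * s) := by
      rw [← Real.exp_add]; exact Real.one_le_exp (by nlinarith)
    have h4 := Phi_le_one z
    rw [hd, hm]
    rw [← hg] at h1
    constructor <;> rw [abs_le] <;> constructor <;> linarith

/-! ### Divergences under exponential tilting -/

lemma abs_exp_sub_one_le_mul_exp (y : ℝ) : |Real.exp y - 1| ≤ |y| * Real.exp |y| := by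
  have h := Complex.norm_exp_sub_sum_le_norm_mul_exp (y : ℂ) 1
  have e : Complex.exp y - 1 = ((Real.exp y - 1 : ℝ) : ℂ) := by push_cast; rfl
  simpa [e, -Complex.ofReal_sub, -Complex.ofReal_exp] using h

lemma abs_exp_sub_one_sub_le_mul_exp (y : ℝ) :
    |Real.exp y - 1 - y| ≤ y ^ 2 * Real.exp |y| := by
  have h := Complex.norm_exp_sub_sum_le_norm_mul_exp (y : ℂ) 2
  have e : Complex.exp y - (1 + y) = ((Real.exp y - 1 - y : ℝ) : ℂ) := by push_cast; ring
  simpa [Finset.sum_range_succ, e, -Complex.ofReal_sub, -Complex.ofReal_exp] using h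

lemma abs_exp_sub_exp_le {a b D : ℝ} (h : |a - b| ≤ D) :
    |Real.exp a - Real.exp b| ≤ |a - b| * Real.exp D * Real.exp a := by
  have h1 : Real.exp a - Real.exp b = -(Real.exp a * (Real.exp (b - a) - 1)) := by
    rw [mul_sub, ← Real.exp_add]; ring_nf
  rw [h1, abs_neg, abs_mul, Real.abs_exp]
  have h2 := abs_exp_sub_one_le_mul_exp (b - a)
  rw [abs_sub_comm b a] at h2
  have h3 := mul_le_mul_of_nonneg_left (Real.exp_le_exp.2 h) (abs_nonneg (a - b))
  have := mul_le_mul_of_nonneg_left (h2.trans h3) (Real.exp_pos a).le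
  linarith

section

variable {P : Measure Cube} [IsProbabilityMeasure P]

/-- Under the measure tilted by `e^{tF}`, a divergence `V = ∑ x_k w_k` has first absolute moment
`O((1 + t) κ)`, if `κ` bounds the interaction `∑ b_k δ_k` of `V` with `F` and `κ²` bounds the
self-interaction `∑ b_k β_k`. Integration by parts in `E[V · V e^{tF}]` bounds the second moment by
a multiple of `t κ E[|V| e^{tF}] + κ² E[e^{tF}]`, and the first term is absorbed. -/
lemma integral_abs_mul_exp_le (hP : FlipInvariant P) {w : ℤ → Cube → ℝ} {b δ β : ℤ → ℝ}
    (hb : Summable b) (hwm : ∀ k, Measurable (w k)) (hw : ∀ k x, |w k x| ≤ b k)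
    (hinv : ∀ k x, w k (flip k x) = w k x) {F V : Cube → ℝ} {c : ℝ}
    (hFm : Measurable F) (hF : ∀ x, |F x| ≤ c) (hV : ∀ x, V x = ∑' k, sgn k x * w k x)
    (hδ : ∀ k x, |F x - F (flip k x)| ≤ δ k) (hβ : ∀ k x, |V x - V (flip k x)| ≤ β k)
    {t D L κ : ℝ} (ht : 0 ≤ t) (hD : ∀ k, t * δ k ≤ D) (hκ : 0 < κ) (hL : 0 ≤ L)
    (hs1 : Summable fun k => b k * δ k) (hs1' : ∑' k, b k * δ k ≤ L * κ)
    (hs2 : Summable fun k => b k * β k) (hs2' : ∑' k, b k * β k ≤ L * κ ^ 2) :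
    ∫ x, |V x| * Real.exp (t * F x) ∂P ≤
      (L * Real.exp D + 1) * ((1 + t) * κ) * ∫ x, Real.exp (t * F x) ∂P := by
  have hVm : Measurable V := by
    rw [funext hV]
    exact measurable_tsum_of_le hb (fun k => by have := hwm k; fun_prop) fun k x => by
      rw [abs_mul, abs_sgn, one_mul]; exact hw k x
  have hVb : ∀ x, |V x| ≤ ∑' k, b k := fun x => by
    rw [hV]
    exact abs_tsum_le hb fun k => by rw [abs_mul, abs_sgn, one_mul]; exact hw k x
  set B := ∑' k, b k with hB
  set E : Cube → ℝ := fun x => Real.exp (t * F x) with hE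
  have hEm : Measurable E := by fun_prop
  have hEb : ∀ x, |E x| ≤ Real.exp (t * c) := fun x => by
    rw [hE, Real.abs_exp]
    exact Real.exp_le_exp.2 (mul_le_mul_of_nonneg_left ((le_abs_self _).trans (hF x)) ht)
  have hE0 : ∀ x, 0 < E x := fun x => Real.exp_pos _
  have hB0 : 0 ≤ B := (abs_nonneg _).trans (hVb (fun _ => true))
  have hb0 : ∀ k, 0 ≤ b k := fun k => (abs_nonneg _).trans (hw k (fun _ => true))
  have iE : Integrable E P := integrable_of_abs_le hEm hEb
  have iVE : Integrable (fun x => |V x| * E x) P :=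
    integrable_of_abs_le (c := B * Real.exp (t * c)) (by fun_prop) fun x => by
      rw [abs_mul, abs_abs]
      exact mul_le_mul (hVb x) (hEb x) (abs_nonneg _) hB0
  have iVVE : Integrable (fun x => V x * (V x * E x)) P :=
    integrable_of_abs_le (c := B * (B * Real.exp (t * c))) (by fun_prop) fun x => by
      rw [abs_mul, abs_mul]
      exact mul_le_mul (hVb x) (mul_le_mul (hVb x) (hEb x) (abs_nonneg _) hB0)
        (by positivity) hB0
  set R := Real.exp D with hR
  have hR0 : 0 < R := Real.exp_pos _
  have hdisc : ∀ k x, |discDeriv k (fun x => V x * E x) x| ≤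
      R / 2 * E x * (t * δ k * |V x| + β k) := by
    intro k x
    have ha : |t * F x - t * F (flip k x)| ≤ t * δ k := by
      rw [← mul_sub, abs_mul, abs_of_nonneg ht]
      exact mul_le_mul_of_nonneg_left (hδ k x) ht
    have hδ0 : 0 ≤ δ k := (abs_nonneg _).trans (hδ k x)
    have h1 : |E x - E (flip k x)| ≤ t * δ k * R * E x :=
      (abs_exp_sub_exp_le (ha.trans (hD k))).trans
        (mul_le_mul_of_nonneg_right (mul_le_mul_of_nonneg_right ha hR0.le) (hE0 x).le)
    have h2 : E (flip k x) ≤ R * E x := by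
      simp only [hE, hR, ← Real.exp_add]
      refine Real.exp_le_exp.2 ?_
      have := (abs_le.1 (ha.trans (hD k))).1
      linarith
    have h3 : V x * E x - V (flip k x) * E (flip k x) =
        V x * (E x - E (flip k x)) + (V x - V (flip k x)) * E (flip k x) := by ring
    have h4 : |V x * (E x - E (flip k x))| ≤ |V x| * (t * δ k * R * E x) := by
      rw [abs_mul]; exact mul_le_mul_of_nonneg_left h1 (abs_nonneg _)
    have h5 : |(V x - V (flip k x)) * E (flip k x)| ≤ β k * (R * E x) := by
      rw [abs_mul, abs_of_pos (hE0 _)]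
      exact mul_le_mul (hβ k x) h2 (hE0 _).le ((abs_nonneg _).trans (hβ k x))
    rw [abs_discDeriv]
    have h6 := abs_add_le (V x * (E x - E (flip k x))) ((V x - V (flip k x)) * E (flip k x))
    rw [h3]
    linarith
  have hpt : ∀ x, ∑' k, w k x * discDeriv k (fun x => V x * E x) x ≤
      R / 2 * (t * (L * κ) * (|V x| * E x) + L * κ ^ 2 * E x) := by
    intro x
    have hsum : HasSum (fun k => R / 2 * E x * (t * |V x|) * (b k * δ k) +
        R / 2 * E x * (b k * β k)) (R / 2 * E x * (t * |V x|) * (∑' k, b k * δ k) +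
        R / 2 * E x * (∑' k, b k * β k)) :=
      (hs1.hasSum.mul_left _).add (hs2.hasSum.mul_left _)
    have h1 := tsum_of_norm_bounded
      (f := fun k => w k x * discDeriv k (fun x => V x * E x) x) hsum fun k => by
        rw [Real.norm_eq_abs, abs_mul]
        have := mul_le_mul (hw k x) (hdisc k x) (abs_nonneg _) (hb0 k)
        linarith
    rw [Real.norm_eq_abs] at h1
    have h2 := mul_le_mul_of_nonneg_left hs1'
      (show 0 ≤ R / 2 * E x * (t * |V x|) by have := hE0 x; positivity)
    have h3 := mul_le_mul_of_nonneg_left hs2'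
      (show 0 ≤ R / 2 * E x by have := hE0 x; positivity)
    have h4 := le_abs_self (∑' k, w k x * discDeriv k (fun x => V x * E x) x)
    linarith
  set M := ∫ x, V x * (V x * E x) ∂P with hM
  set A := ∫ x, |V x| * E x ∂P with hA
  set N := ∫ x, E x ∂P with hN
  have hN0 : 0 ≤ N := integral_nonneg fun x => (hE0 x).le
  have hMle : M ≤ R / 2 * (t * (L * κ) * A + L * κ ^ 2 * N) := by
    have hVEb : ∀ x, |V x * E x| ≤ B * Real.exp (t * c) := fun x => by
      rw [abs_mul]; exact mul_le_mul (hVb x) (hEb x) (abs_nonneg _) hB0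
    have e := integral_tsum_sgn_mul hP hb hwm hw hinv (h := fun x => V x * E x)
      (by fun_prop) hVEb
    simp_rw [← hV] at e
    rw [hM, e, hA, hN, ← integral_const_mul, ← integral_const_mul,
      ← integral_add (iVE.const_mul _) (iE.const_mul _), ← integral_const_mul]
    exact integral_mono (integrable_tsum_mul_discDeriv hb hwm hw (by fun_prop) hVEb)
      (((iVE.const_mul _).add (iE.const_mul _)).const_mul _) hpt
  have young : ∀ lam : ℝ, 2 * lam * A ≤ M + lam ^ 2 * N := by
    intro lam
    rw [hM, hA, hN, ← integral_const_mul, ← integral_const_mul,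
      ← integral_add iVVE (iE.const_mul _)]
    refine integral_mono (iVE.const_mul _) (iVVE.add (iE.const_mul _)) fun x => ?_
    have h1 := mul_nonneg (sq_nonneg (|V x| - lam)) (hE0 x).le
    have h2 : V x * (V x * E x) = |V x| ^ 2 * E x := by rw [sq_abs]; ring
    rw [h2]
    linarith
  -- the first choice of the parameter absorbs the interaction term into the second moment
  have hy1 := young (R * (t * (L * κ)))
  have hM2 : M ≤ ((L * R + 1) * ((1 + t) * κ)) ^ 2 * N := by
    have h1 : M ≤ ((R * (t * (L * κ))) ^ 2 + 2 * (R * L * κ ^ 2)) * N := by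
      have ha : 0 ≤ (R * (t * (L * κ))) ^ 2 * N := by positivity
      have hb : 0 ≤ R * L * κ ^ 2 * N := by positivity
      linarith
    refine h1.trans (mul_le_mul_of_nonneg_right ?_ hN0)
    have hRL : 0 ≤ L * R := by positivity
    have : ((L * R + 1) * ((1 + t) * κ)) ^ 2 -
      ((R * (t * (L * κ))) ^ 2 + 2 * (R * L * κ ^ 2)) =
      κ ^ 2 * ((L * R) ^ 2 * (1 + 2 * t) + 2 * (L * R) * (2 * t + t ^ 2) + (1 + t) ^ 2) := by ring
    have h2 : 0 ≤ κ ^ 2 * ((L * R) ^ 2 * (1 + 2 * t) + 2 * (L * R) * (2 * t + t ^ 2) +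
      (1 + t) ^ 2) := by positivity
    linarith
  have hy2 := young ((L * R + 1) * ((1 + t) * κ))
  have hpos : 0 < (L * R + 1) * ((1 + t) * κ) := by positivity
  refine le_of_mul_le_mul_left ?_ (mul_pos two_pos hpos)
  nlinarith

end

/-! ### Local norms of the coefficient sequence -/

/-- The `ℓ¹` norm of `α` on the window of radius `4` about `k`; it dominates all local quantities
attached to the site `k`. -/
noncomputable def winSum (α : ℤ → ℝ) (k : ℤ) : ℝ := ∑ i ∈ Finset.Icc (-4 : ℤ) 4, |α (k + i)|

lemma winSum_nonneg (α : ℤ → ℝ) (k : ℤ) : 0 ≤ winSum α k :=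
  Finset.sum_nonneg fun _ _ => abs_nonneg _

lemma abs_le_winSum (α : ℤ → ℝ) {j k : ℤ} (h : |j - k| ≤ 4) : |α j| ≤ winSum α k := by
  have hm : j - k ∈ Finset.Icc (-4 : ℤ) 4 := Finset.mem_Icc.2 (abs_le.1 h)
  have := Finset.single_le_sum (f := fun i => |α (k + i)|) (fun _ _ => abs_nonneg _) hm
  rw [add_sub_cancel] at this
  exact this

lemma summable_comp_add {f : ℤ → ℝ} (hf : Summable f) (i : ℤ) : Summable fun k => f (k + i) :=
  (Equiv.addRight i).summable_iff.2 hf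

lemma tsum_comp_add (f : ℤ → ℝ) (i : ℤ) : ∑' k, f (k + i) = ∑' k, f k :=
  (Equiv.addRight i).tsum_eq f

lemma summable_winSum {α : ℤ → ℝ} (hα : Summable fun k => |α k|) : Summable (winSum α) :=
  summable_sum fun i _ => summable_comp_add hα i

lemma summable_pow_succ {f : ℤ → ℝ} (hf : Summable f) (h0 : ∀ k, 0 ≤ f k) (n : ℕ) :
    Summable fun k => f k ^ (n + 1) := by
  refine Summable.of_nonneg_of_le (fun k => pow_nonneg (h0 k) _) (fun k => ?_)
    (hf.mul_left ((∑' k, f k) ^ n))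
  rw [pow_succ]
  exact mul_le_mul_of_nonneg_right
    (pow_le_pow_left₀ (h0 k) (hf.le_tsum k fun j _ => h0 j) n) (h0 k)

lemma tsum_winSum_pow_le {α : ℤ → ℝ} (hα : Summable fun k => |α k|) (n : ℕ) :
    ∑' k, winSum α k ^ (n + 1) ≤ 9 ^ (n + 1) * ∑' k, |α k| ^ (n + 1) := by
  have hs := summable_pow_succ hα (fun _ => abs_nonneg _) n
  have hp : ∀ k, winSum α k ^ (n + 1) ≤
      9 ^ n * ∑ i ∈ Finset.Icc (-4 : ℤ) 4, |α (k + i)| ^ (n + 1) := fun k => by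
    have := pow_sum_div_card_le_sum_pow (s := Finset.Icc (-4 : ℤ) 4) (f := fun i => |α (k + i)|)
      (fun _ _ => abs_nonneg _) n
    rw [div_le_iff₀ (by simp)] at this
    simp at this
    rw [mul_comm]; exact this
  have hsum : Summable fun k => 9 ^ n * ∑ i ∈ Finset.Icc (-4 : ℤ) 4, |α (k + i)| ^ (n + 1) :=
    (summable_sum fun i _ => summable_comp_add hs i).mul_left _
  refine ((summable_pow_succ (summable_winSum hα) (winSum_nonneg α) n).tsum_le_tsum hp hsum).trans
    (le_of_eq ?_)
  rw [tsum_mul_left, Summable.tsum_finsetSum fun i _ => summable_comp_add hs i]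
  simp_rw [tsum_comp_add (fun k => |α k| ^ (n + 1))]
  simp
  ring

/-- The coefficient sequence `α` gives the series `∑ x_k (α_{k-1} + α_k + α_k x_{k+1})` unit
variance, and `κ` is the square of its `ℓ⁴` norm. -/
structure IsNormalized (α : ℤ → ℝ) (κ : ℝ) : Prop where
  summable : Summable fun k => |α k|
  variance_eq_one : ∑' k, ((α (k - 1) + α k) ^ 2 + α k ^ 2) = 1
  pos : 0 < κ
  sum_four : ∑' k, |α k| ^ 4 = κ ^ 2

section Normalized

variable {α : ℤ → ℝ} {κ : ℝ}

lemma summable_variance_terms (hα : Summable fun k => |α k|) :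
    Summable fun k => (α (k - 1) + α k) ^ 2 + α k ^ 2 := by
  have h2 := summable_pow_succ hα (fun _ => abs_nonneg _) 1
  have h3 := summable_pow_succ (summable_winSum hα) (winSum_nonneg α) 1
  refine Summable.of_nonneg_of_le (fun k => by positivity) (fun k => ?_) (h3.mul_left 5)
  have h4 := abs_le_winSum α (j := k - 1) (k := k) (by norm_num)
  have h5 := abs_le_winSum α (j := k) (k := k) (by norm_num)
  have h6 : (α (k - 1) + α k) ^ 2 ≤ (2 * winSum α k) ^ 2 :=
    sq_le_sq' (by linarith [(abs_le.1 h4).1, (abs_le.1 h5).1])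
      (by linarith [(abs_le.1 h4).2, (abs_le.1 h5).2])
  have h7 : α k ^ 2 ≤ winSum α k ^ 2 := sq_le_sq' (abs_le.1 h5).1 (abs_le.1 h5).2
  norm_num
  linarith

lemma IsNormalized.summable_winSum_pow (h : IsNormalized α κ) (n : ℕ) :
    Summable fun k => winSum α k ^ (n + 1) :=
  summable_pow_succ (summable_winSum h.summable) (winSum_nonneg α) n

lemma IsNormalized.tsum_winSum_sq (h : IsNormalized α κ) : ∑' k, winSum α k ^ 2 ≤ 81 := by
  have h1 := tsum_winSum_pow_le h.summable 1
  have h2 : ∑' k, |α k| ^ 2 ≤ 1 := by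
    rw [← h.variance_eq_one]
    refine (summable_pow_succ h.summable (fun _ => abs_nonneg _) 1).tsum_le_tsum (fun k => ?_)
      (summable_variance_terms h.summable)
    rw [sq_abs]
    nlinarith [sq_nonneg (α (k - 1) + α k)]
  norm_num at h1
  norm_num at h2
  linarith

lemma IsNormalized.tsum_winSum_four (h : IsNormalized α κ) :
    ∑' k, winSum α k ^ 4 ≤ 6561 * κ ^ 2 := by
  have h1 : ∑' k, winSum α k ^ 4 ≤ 9 ^ 4 * ∑' k, |α k| ^ 4 := tsum_winSum_pow_le h.summable 3
  rw [h.sum_four] at h1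
  linarith

/-- Interpolation of the third power between the second and the fourth. -/
lemma IsNormalized.tsum_winSum_three (h : IsNormalized α κ) :
    ∑' k, winSum α k ^ 3 ≤ 3321 * κ := by
  have hκ := h.pos
  have h1 : ∀ k, winSum α k ^ 3 ≤ κ / 2 * winSum α k ^ 2 + 1 / (2 * κ) * winSum α k ^ 4 := by
    intro k
    have : κ / 2 * winSum α k ^ 2 + 1 / (2 * κ) * winSum α k ^ 4 - winSum α k ^ 3 =
        winSum α k ^ 2 * (winSum α k - κ) ^ 2 / (2 * κ) := by field_simp; ring
    have : 0 ≤ winSum α k ^ 2 * (winSum α k - κ) ^ 2 / (2 * κ) := by positivity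
    linarith
  have s2 := (h.summable_winSum_pow 1).mul_left (κ / 2)
  have s4 := (h.summable_winSum_pow 3).mul_left (1 / (2 * κ))
  have h2 := (h.summable_winSum_pow 2).tsum_le_tsum h1 (s2.add s4)
  rw [s2.tsum_add s4, tsum_mul_left, tsum_mul_left] at h2
  have h3 := mul_le_mul_of_nonneg_left h.tsum_winSum_sq (show 0 ≤ κ / 2 by positivity)
  have h4 := mul_le_mul_of_nonneg_left h.tsum_winSum_four (show 0 ≤ 1 / (2 * κ) by positivity)
  have h5 : 1 / (2 * κ) * (6561 * κ ^ 2) = 6561 / 2 * κ := by field_simp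
  norm_num at h2 h3 h4 h5 ⊢
  linarith

lemma IsNormalized.mul_winSum_le (h : IsNormalized α κ) {t : ℝ}
    (htκ : t ^ 2 * κ ≤ 1) (k : ℤ) : t * winSum α k ≤ 9 := by
  have h1 : winSum α k ^ 4 ≤ 6561 * κ ^ 2 :=
    ((h.summable_winSum_pow 3).le_tsum k fun j _ => pow_nonneg (winSum_nonneg α j) _).trans
      h.tsum_winSum_four
  have h2 : winSum α k ^ 2 ≤ 81 * κ := by
    refine abs_le_of_sq_le_sq' ?_ (by linarith [h.pos]) |>.2
    nlinarith
  refine abs_le_of_sq_le_sq' ?_ (by norm_num) |>.2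
  have := mul_le_mul_of_nonneg_left h2 (sq_nonneg t)
  nlinarith

end Normalized

/-! ### The weighted 2-run as a divergence -/

/-- The weight of the `k`-th sign in the centred 2-run. It involves the later sign `k + 1` only, so
that each product `x_k x_{k+1}` is counted once. -/
noncomputable def weight (α : ℤ → ℝ) (k : ℤ) (x : Cube) : ℝ :=
  α (k - 1) + α k + α k * sgn (k + 1) x

/-- The discrete derivative of the centred 2-run. -/
noncomputable def grad (α : ℤ → ℝ) (k : ℤ) (x : Cube) : ℝ :=
  α (k - 1) + α k + α k * sgn (k + 1) x + α (k - 1) * sgn (k - 1) x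

/-- The centred 2-run `∑ x_k (α_{k-1} + α_k + α_k x_{k+1})`. -/
noncomputable def run (α : ℤ → ℝ) (x : Cube) : ℝ := ∑' k, sgn k x * weight α k x

/-- The Stein kernel `∑ u_k d_k` of the centred 2-run, where `u` are its weights and `d` is its
gradient. -/
noncomputable def steinKer (α : ℤ → ℝ) (x : Cube) : ℝ := ∑' k, weight α k x * grad α k x

/-- The weights that represent the centred Stein kernel as a divergence. -/
noncomputable def kerWeight (α : ℤ → ℝ) (j : ℤ) (x : Cube) : ℝ :=
  2 * (α (j - 2) + α (j - 1)) * α (j - 1) + (α j + α (j + 1)) * α j +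
    α (j + 1) * α j * sgn (j + 2) x

@[fun_prop] lemma measurable_weight (α : ℤ → ℝ) (k : ℤ) : Measurable (weight α k) := by
  unfold weight; fun_prop

@[fun_prop] lemma measurable_grad (α : ℤ → ℝ) (k : ℤ) : Measurable (grad α k) := by
  unfold grad; fun_prop

@[fun_prop] lemma measurable_kerWeight (α : ℤ → ℝ) (k : ℤ) : Measurable (kerWeight α k) := by
  unfold kerWeight; fun_prop

lemma weight_flip_self (α : ℤ → ℝ) (k : ℤ) (x : Cube) :
    weight α k (flip k x) = weight α k x := by
  unfold weight; rw [sgn_flip_of_ne (by omega)]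

lemma grad_flip_self (α : ℤ → ℝ) (k : ℤ) (x : Cube) : grad α k (flip k x) = grad α k x := by
  unfold grad; rw [sgn_flip_of_ne (by omega), sgn_flip_of_ne (by omega)]

lemma kerWeight_flip_self (α : ℤ → ℝ) (k : ℤ) (x : Cube) :
    kerWeight α k (flip k x) = kerWeight α k x := by
  unfold kerWeight; rw [sgn_flip_of_ne (by omega)]

section LocalBounds

variable {α : ℤ → ℝ} {k : ℤ} {m : ℝ}

lemma abs_weight_le (h : ∀ i, |i - k| ≤ 2 → |α i| ≤ m) (x : Cube) : |weight α k x| ≤ 3 * m := by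
  have h1 := h (k - 1) (by norm_num)
  have h2 := h k (by norm_num)
  have h3 : |α k * sgn (k + 1) x| ≤ m := by rwa [abs_mul, abs_sgn, mul_one]
  unfold weight
  rw [abs_le] at *
  constructor <;> linarith

lemma abs_grad_le (h : ∀ i, |i - k| ≤ 2 → |α i| ≤ m) (x : Cube) : |grad α k x| ≤ 4 * m := by
  have h1 := abs_weight_le h x
  have h2 := h (k - 1) (by norm_num)
  have h3 : |α (k - 1) * sgn (k - 1) x| ≤ m := by rwa [abs_mul, abs_sgn, mul_one]
  unfold weight at h1
  unfold grad
  rw [abs_le] at *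
  constructor <;> linarith

lemma abs_weight_mul_grad_le (h : ∀ i, |i - k| ≤ 2 → |α i| ≤ m) (x : Cube) :
    |(|weight α k x| * grad α k x)| ≤ 12 * m ^ 2 := by
  rw [abs_mul, abs_abs]
  have h1 := abs_weight_le h x
  have := mul_le_mul h1 (abs_grad_le h x) (abs_nonneg _) ((abs_nonneg _).trans h1)
  linarith

lemma abs_kerWeight_le (h : ∀ i, |i - k| ≤ 2 → |α i| ≤ m) (x : Cube) :
    |kerWeight α k x| ≤ 12 * m ^ 2 := by
  have h1 := h (k - 2) (by norm_num)
  have h2 := h (k - 1) (by norm_num)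
  have h3 := h k (by norm_num)
  have h4 := h (k + 1) (by norm_num)
  have hm : 0 ≤ m := (abs_nonneg _).trans h1
  have hp : ∀ {a b : ℝ}, |a| ≤ m → |b| ≤ m → |a * b| ≤ m ^ 2 := fun ha hb => by
    rw [abs_mul, sq]; exact mul_le_mul ha hb (abs_nonneg _) hm
  have p1 := abs_le.1 (hp h1 h2)
  have p2 := abs_le.1 (hp h2 h2)
  have p3 := abs_le.1 (hp h3 h3)
  have p4 := abs_le.1 (hp h4 h3)
  have p5 : |α (k + 1) * α k * sgn (k + 2) x| ≤ m ^ 2 := by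
    rw [abs_mul _ (sgn _ _), abs_sgn, mul_one]; exact hp h4 h3
  rw [abs_le] at p5
  unfold kerWeight
  rw [abs_le]
  have := sq_nonneg m
  constructor <;> linarith

end LocalBounds

lemma abs_le_winSum_of_near (α : ℤ → ℝ) {k : ℤ} :
    ∀ i, |i - k| ≤ 2 → |α i| ≤ winSum α k :=
  fun _ hi => abs_le_winSum α (hi.trans (by norm_num))

section Run

variable {α : ℤ → ℝ}

lemma summable_weight_bound (hα : Summable fun k => |α k|) :
    Summable fun k => 3 * winSum α k := (summable_winSum hα).mul_left 3

lemma abs_sgn_mul_weight_le (k : ℤ) (x : Cube) :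
    |sgn k x * weight α k x| ≤ 3 * winSum α k := by
  rw [abs_mul, abs_sgn, one_mul]
  exact abs_weight_le (abs_le_winSum_of_near α) x

lemma abs_run_le (hα : Summable fun k => |α k|) (x : Cube) :
    |run α x| ≤ ∑' k, 3 * winSum α k :=
  abs_tsum_le (summable_weight_bound hα) fun k => abs_sgn_mul_weight_le k x

lemma measurable_run (hα : Summable fun k => |α k|) : Measurable (run α) :=
  measurable_tsum_of_le (summable_weight_bound hα) (fun k => by fun_prop) abs_sgn_mul_weight_le

lemma tsum_sub_tsum_flip {v : ℤ → Cube → ℝ} (hv : ∀ x, Summable fun k => v k x) {j : ℤ}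
    {s : Finset ℤ} (x : Cube) (hloc : ∀ k ∉ s, v k (flip j x) = v k x) :
    ∑' k, v k x - ∑' k, v k (flip j x) = ∑ k ∈ s, (v k x - v k (flip j x)) := by
  rw [← (hv x).tsum_sub (hv (flip j x))]
  exact tsum_eq_sum fun k hk => by rw [hloc k hk, sub_self]

lemma run_sub_run_flip (hα : Summable fun k => |α k|) (j : ℤ) (x : Cube) :
    run α x - run α (flip j x) = 2 * sgn j x * grad α j x := by
  unfold run
  rw [tsum_sub_tsum_flip (v := fun k x => sgn k x * weight α k x) (s := {j - 1, j})
    (fun x => summable_of_abs_le (summable_weight_bound hα) fun k => abs_sgn_mul_weight_le k x) x]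
  · rw [Finset.sum_pair (by omega), weight_flip_self, sgn_flip_self, sgn_flip_of_ne (by omega)]
    unfold weight grad
    simp only [sub_add_cancel, sgn_flip_self]
    ring
  · intro k hk
    simp only [Finset.mem_insert, Finset.mem_singleton, not_or] at hk
    unfold weight
    rw [sgn_flip_of_ne hk.2, sgn_flip_of_ne (by omega)]

lemma discDeriv_run (hα : Summable fun k => |α k|) (k : ℤ) (x : Cube) :
    discDeriv k (run α) x = grad α k x := by
  rw [discDeriv, run_sub_run_flip hα]
  have := sgn_sq k x
  linear_combination grad α k x * this

lemma abs_run_sub_run_flip_le (hα : Summable fun k => |α k|) (j : ℤ) (x : Cube) :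
    |run α x - run α (flip j x)| ≤ 8 * winSum α j := by
  rw [run_sub_run_flip hα, abs_mul, abs_mul, abs_sgn, abs_two]
  have := abs_grad_le (abs_le_winSum_of_near α) (k := j) x
  linarith

/-- The Stein kernel differs from its mean by a divergence. -/
lemma steinKer_eq (hα : Summable fun k => |α k|) (x : Cube) :
    steinKer α x = ∑' k, ((α (k - 1) + α k) ^ 2 + α k ^ 2) +
      ∑' k, sgn k x * kerWeight α k x := by
  have hw := summable_pow_succ (summable_winSum hα) (winSum_nonneg α) 1
  have b : ∀ {i j k : ℤ}, |i - k| ≤ 4 → |j - k| ≤ 4 → |α i * α j| ≤ winSum α k ^ 2 :=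
    fun hi hj => by
      rw [abs_mul, sq]
      exact mul_le_mul (abs_le_winSum α hi) (abs_le_winSum α hj) (abs_nonneg _)
        (winSum_nonneg α _)
  set f1 : ℤ → ℝ := fun j => sgn j x * (2 * (α (j - 2) + α (j - 1)) * α (j - 1)) with hf1
  set f2 : ℤ → ℝ := fun j =>
    sgn j x * ((α j + α (j + 1)) * α j + α (j + 1) * α j * sgn (j + 2) x) with hf2
  have s1 : Summable f1 := by
    refine summable_of_abs_le (hw.mul_left 4) fun k => ?_
    rw [hf1, abs_mul, abs_sgn, one_mul]
    have p1 := abs_le.1 (b (i := k - 2) (j := k - 1) (k := k) (by norm_num) (by norm_num))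
    have p2 := abs_le.1 (b (i := k - 1) (j := k - 1) (k := k) (by norm_num) (by norm_num))
    rw [abs_le]; norm_num at p1 p2 ⊢
    constructor <;> linarith
  have s2 : Summable f2 := by
    refine summable_of_abs_le (hw.mul_left 3) fun k => ?_
    rw [hf2, abs_mul, abs_sgn, one_mul]
    have p1 := abs_le.1 (b (i := k) (j := k) (k := k) (by norm_num) (by norm_num))
    have p2 := b (i := k + 1) (j := k) (k := k) (by norm_num) (by norm_num)
    have p3 : |α (k + 1) * α k * sgn (k + 2) x| ≤ winSum α k ^ 2 := by
      rwa [abs_mul _ (sgn _ _), abs_sgn, mul_one]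
    rw [abs_le] at *
    norm_num at p1 p2 p3 ⊢
    constructor <;> linarith
  have e1 : ∑' k, f1 (k + 1) = ∑' k, f1 k := tsum_comp_add f1 1
  have e2 : ∑' k, f2 (k + -1) = ∑' k, f2 k := tsum_comp_add f2 (-1)
  have e3 : ∑' k, sgn k x * kerWeight α k x = ∑' k, f1 k + ∑' k, f2 k := by
    rw [← s1.tsum_add s2]
    refine tsum_congr fun k => ?_
    simp only [hf1, hf2, kerWeight]; ring
  rw [e3, ← e1, ← e2, ← (summable_comp_add s1 1).tsum_add (summable_comp_add s2 (-1)),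
    ← (summable_variance_terms hα).tsum_add
      ((summable_comp_add s1 1).add (summable_comp_add s2 (-1)))]
  refine tsum_congr fun k => ?_
  have i1 : k + 1 - 2 = k - 1 := by ring
  have i2 : k + 1 - 1 = k := by ring
  have i3 : k + -1 = k - 1 := by ring
  have i4 : k - 1 + 1 = k := by ring
  have i5 : k - 1 + 2 = k + 1 := by ring
  simp only [hf1, hf2, i1, i2, i3, i4, i5, weight, grad]
  linear_combination α k ^ 2 * sgn_sq (k + 1) x

end Run

/-! ### Exponential moments of the 2-run -/

section

variable {P : Measure Cube} [IsProbabilityMeasure P] {α : ℤ → ℝ} {κ : ℝ}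

/-- The constant in the tilted moment bounds for normalized 2-runs. -/
noncomputable def tiltConst : ℝ := 10 ^ 7 * Real.exp 72 + 1

lemma tiltConst_pos : 0 < tiltConst := by unfold tiltConst; positivity

/-- First absolute moments, under exponential tilting, of divergences whose `k`-th weight is local
and quadratic in the coefficients near `k`. -/
lemma IsNormalized.integral_abs_div_mul_exp_le (h : IsNormalized α κ) (hP : FlipInvariant P)
    {w : ℤ → Cube → ℝ} (hwm : ∀ k, Measurable (w k))
    (hw : ∀ k m x, (∀ i, |i - k| ≤ 2 → |α i| ≤ m) → |w k x| ≤ 12 * m ^ 2)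
    (hinv : ∀ k x, w k (flip k x) = w k x)
    (hloc : ∀ j k x, 2 < |k - j| → w k (flip j x) = w k x)
    {t : ℝ} (ht : 0 ≤ t) (htκ : t ^ 2 * κ ≤ 1) :
    ∫ x, |∑' k, sgn k x * w k x| * Real.exp (t * run α x) ∂P ≤
      tiltConst * ((1 + t) * κ) * ∫ x, Real.exp (t * run α x) ∂P := by
  have hα := h.summable
  have hκ := h.pos
  have hwb : ∀ k x, |w k x| ≤ 12 * winSum α k ^ 2 := fun k x => hw k _ x (abs_le_winSum_of_near α)
  have hb : Summable fun k => 12 * winSum α k ^ 2 := (h.summable_winSum_pow 1).mul_left 12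
  -- a flip at `j` changes only the five terms with `|k - j| ≤ 2`
  have hsens : ∀ j x, |∑' k, sgn k x * w k x - ∑' k, sgn k (flip j x) * w k (flip j x)| ≤
      120 * winSum α j ^ 2 := by
    intro j x
    rw [tsum_sub_tsum_flip (v := fun k x => sgn k x * w k x) (s := Finset.Icc (j - 2) (j + 2))
      (fun x => summable_of_abs_le hb fun k => by
        rw [abs_mul, abs_sgn, one_mul]; exact hwb k x) x]
    · have hterm : ∀ k ∈ Finset.Icc (j - 2) (j + 2),
          |sgn k x * w k x - sgn k (flip j x) * w k (flip j x)| ≤ 24 * winSum α j ^ 2 := by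
        intro k hk
        rw [Finset.mem_Icc] at hk
        have hnear : ∀ i, |i - k| ≤ 2 → |α i| ≤ winSum α j := fun i hi =>
          abs_le_winSum α (abs_le.2 ⟨by have := (abs_le.1 hi).1; omega,
            by have := (abs_le.1 hi).2; omega⟩)
        have h1 := abs_sub (sgn k x * w k x) (sgn k (flip j x) * w k (flip j x))
        rw [abs_mul, abs_mul, abs_sgn, abs_sgn, one_mul, one_mul] at h1
        have h2 := hw k _ x hnear
        have h3 := hw k _ (flip j x) hnear
        linarith
      refine (Finset.abs_sum_le_sum_abs _ _).trans ((Finset.sum_le_sum hterm).trans (le_of_eq ?_))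
      rw [Finset.sum_const, Int.card_Icc, show (j + 2 + 1 - (j - 2)).toNat = 5 by omega]
      norm_num; ring
    · intro k hk
      have hk' : 2 < |k - j| := by
        by_contra hcon
        have := abs_le.1 (not_lt.1 hcon)
        exact hk (Finset.mem_Icc.2 ⟨by omega, by omega⟩)
      rw [hloc j k x hk', sgn_flip_of_ne]
      rintro rfl
      simp at hk'
  have s3 : ∀ c : ℝ, Summable fun k => c * winSum α k ^ 3 := fun c =>
    (h.summable_winSum_pow 2).mul_left c
  have s4 : ∀ c : ℝ, Summable fun k => c * winSum α k ^ 4 := fun c =>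
    (h.summable_winSum_pow 3).mul_left c
  have e1 : (fun k => 12 * winSum α k ^ 2 * (8 * winSum α k)) = fun k => 96 * winSum α k ^ 3 := by
    ext k; ring
  have e2 : (fun k => 12 * winSum α k ^ 2 * (120 * winSum α k ^ 2)) =
      fun k => 1440 * winSum α k ^ 4 := by
    ext k; ring
  -- `72 = 8 * 9` bounds `t * 8 * winSum α k`, the change of `t * run α` under a flip
  refine integral_abs_mul_exp_le (D := 72) (L := 10 ^ 7) (F := run α) hP hb hwm hwb hinv
    (measurable_run hα) (abs_run_le hα) (fun x => rfl) (abs_run_sub_run_flip_le hα) hsens ht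
    (fun k => ?_) hκ (by norm_num) (by rw [e1]; exact s3 _) ?_ (by rw [e2]; exact s4 _) ?_
  · have := h.mul_winSum_le htκ k
    linarith
  · rw [e1, tsum_mul_left]
    have := h.tsum_winSum_three
    linarith
  · rw [e2, tsum_mul_left]
    have := h.tsum_winSum_four
    have := sq_nonneg κ
    linarith

/-- The Stein kernel is close to `1` under exponential tilting. -/
lemma IsNormalized.integral_abs_steinKer_sub_one_le (h : IsNormalized α κ) (hP : FlipInvariant P)
    {t : ℝ} (ht : 0 ≤ t) (htκ : t ^ 2 * κ ≤ 1) :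
    ∫ x, |steinKer α x - 1| * Real.exp (t * run α x) ∂P ≤
      tiltConst * ((1 + t) * κ) * ∫ x, Real.exp (t * run α x) ∂P := by
  have e : ∀ x, steinKer α x - 1 = ∑' k, sgn k x * kerWeight α k x := fun x => by
    rw [steinKer_eq h.summable, h.variance_eq_one]; ring
  simp_rw [e]
  refine h.integral_abs_div_mul_exp_le hP (fun k => by fun_prop)
    (fun k m x hm => abs_kerWeight_le hm x) (kerWeight_flip_self α) (fun j k x hjk => ?_) ht htκ
  unfold kerWeight
  rw [sgn_flip_of_ne]
  rintro rfl
  norm_num at hjk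

/-- The divergence of `|u_k| d_k`, which controls the discretization error in the Stein
identity. -/
noncomputable def errDiv (α : ℤ → ℝ) (x : Cube) : ℝ :=
  ∑' k, sgn k x * (|weight α k x| * grad α k x)

lemma IsNormalized.integral_abs_errDiv_le (h : IsNormalized α κ) (hP : FlipInvariant P)
    {t : ℝ} (ht : 0 ≤ t) (htκ : t ^ 2 * κ ≤ 1) :
    ∫ x, |errDiv α x| * Real.exp (t * run α x) ∂P ≤
      tiltConst * ((1 + t) * κ) * ∫ x, Real.exp (t * run α x) ∂P := by
  refine h.integral_abs_div_mul_exp_le hP (w := fun k x => |weight α k x| * grad α k x)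
    (fun k => ?_) (fun k m x hm => abs_weight_mul_grad_le hm x)
    (fun k x => by rw [weight_flip_self, grad_flip_self]) (fun j k x hjk => ?_) ht htκ
  · exact (measurable_weight α k).abs.mul (measurable_grad α k)
  · have h1 : k + 1 ≠ j := by rintro rfl; norm_num at hjk
    have h2 : k - 1 ≠ j := by rintro rfl; norm_num at hjk
    unfold weight grad
    rw [sgn_flip_of_ne h1, sgn_flip_of_ne h2]

lemma measurable_steinKer (hα : Summable fun k => |α k|) : Measurable (steinKer α) := by
  refine measurable_tsum_of_le
    ((summable_pow_succ (summable_winSum hα) (winSum_nonneg α) 1).mul_left 12)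
    (fun k => by fun_prop) fun k x => ?_
  have := abs_weight_mul_grad_le (abs_le_winSum_of_near α) (k := k) x
  rwa [abs_mul, abs_abs, ← abs_mul] at this

lemma summable_weight_mul_grad (hα : Summable fun k => |α k|) (x : Cube) :
    Summable fun k => weight α k x * grad α k x := by
  refine summable_of_abs_le
    ((summable_pow_succ (summable_winSum hα) (winSum_nonneg α) 1).mul_left 12) fun k => ?_
  have := abs_weight_mul_grad_le (abs_le_winSum_of_near α) (k := k) x
  rwa [abs_mul, abs_abs, ← abs_mul] at this

lemma exists_abs_steinKer_le (hα : Summable fun k => |α k|) : ∃ c, ∀ x, |steinKer α x| ≤ c := by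
  refine ⟨_, fun x => abs_tsum_le
    ((summable_pow_succ (summable_winSum hα) (winSum_nonneg α) 1).mul_left 12) fun k => ?_⟩
  have := abs_weight_mul_grad_le (abs_le_winSum_of_near α) (k := k) x
  rwa [abs_mul, abs_abs, ← abs_mul] at this

lemma abs_discDeriv_exp_sub_le (hα : Summable fun k => |α k|) {t : ℝ} (ht : 0 ≤ t) (k : ℤ)
    (htA : t * winSum α k ≤ 9) (x : Cube) :
    |discDeriv k (fun x => Real.exp (t * run α x)) x -
      t * grad α k x * Real.exp (t * run α x)| ≤
      32 * Real.exp 72 * t ^ 2 * winSum α k ^ 2 * Real.exp (t * run α x) := by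
  set y := -(2 * t * (sgn k x * grad α k x)) with hy
  have hg := abs_grad_le (abs_le_winSum_of_near α) (k := k) x
  have hyabs : |y| ≤ 8 * (t * winSum α k) := by
    rw [hy, abs_neg, abs_mul, abs_mul, abs_mul, abs_sgn, abs_two, abs_of_nonneg ht, one_mul]
    have := mul_le_mul_of_nonneg_left hg ht
    linarith
  have e1 : Real.exp (t * run α (flip k x)) = Real.exp (t * run α x) * Real.exp y := by
    rw [← Real.exp_add]
    congr 1
    have := run_sub_run_flip hα k x
    rw [hy]; linear_combination -t * this
  have e2 : discDeriv k (fun x => Real.exp (t * run α x)) x -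
      t * grad α k x * Real.exp (t * run α x) =
      -(sgn k x * (Real.exp y - 1 - y) / 2 * Real.exp (t * run α x)) := by
    rw [discDeriv, e1]
    have : sgn k x * y = -(2 * t * grad α k x) := by
      rw [hy]; linear_combination -2 * t * grad α k x * sgn_sq k x
    linear_combination -Real.exp (t * run α x) / 2 * this
  rw [e2, abs_neg, abs_mul, Real.abs_exp, abs_div, abs_mul, abs_sgn, one_mul, abs_two]
  refine mul_le_mul_of_nonneg_right ?_ (Real.exp_pos _).le
  have h1 := abs_exp_sub_one_sub_le_mul_exp y
  have h2 : Real.exp |y| ≤ Real.exp 72 := Real.exp_le_exp.2 (by linarith)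
  have h3 : y ^ 2 ≤ (8 * (t * winSum α k)) ^ 2 := by
    rw [← sq_abs]; exact pow_le_pow_left₀ (abs_nonneg _) hyabs 2
  have h4 := mul_le_mul h3 h2 (Real.exp_pos _).le (by positivity)
  linarith

lemma integrable_exp_run (hα : Summable fun k => |α k|) (t : ℝ) :
    Integrable (fun x => Real.exp (t * run α x)) P := by
  have := measurable_run hα
  refine integrable_of_abs_le (c := Real.exp (|t| * ∑' k, 3 * winSum α k)) (by fun_prop) fun x => ?_
  rw [Real.abs_exp]
  refine Real.exp_le_exp.2 ((le_abs_self _).trans ?_)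
  rw [abs_mul]
  exact mul_le_mul_of_nonneg_left (abs_run_le hα x) (abs_nonneg t)

/-- The differential inequality `N' ≤ (t + O((t + t²) κ)) N` for the moment generating function
`N`. -/
lemma IsNormalized.integral_run_mul_exp_le (h : IsNormalized α κ) (hP : FlipInvariant P)
    {t : ℝ} (ht : 0 ≤ t) (htκ : t ^ 2 * κ ≤ 1) :
    ∫ x, run α x * Real.exp (t * run α x) ∂P ≤
      (t + tiltConst * κ * (t + 2 * t ^ 2)) * ∫ x, Real.exp (t * run α x) ∂P := by
  have hα := h.summable
  have hκ := h.pos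
  have hm := measurable_run hα
  have hkm := measurable_steinKer hα
  obtain ⟨cK, hcK⟩ := exists_abs_steinKer_le hα
  set B := ∑' k, 3 * winSum α k
  have hEb : ∀ x, |Real.exp (t * run α x)| ≤ Real.exp (t * B) := fun x => by
    rw [Real.abs_exp]
    exact Real.exp_le_exp.2
      (mul_le_mul_of_nonneg_left ((le_abs_self _).trans (abs_run_le hα x)) ht)
  have hub : ∀ k x, |weight α k x| ≤ 3 * winSum α k := fun k x =>
    abs_weight_le (abs_le_winSum_of_near α) x
  have ibp := integral_tsum_sgn_mul hP (summable_weight_bound hα) (measurable_weight α) hub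
    (weight_flip_self α) (h := fun x => Real.exp (t * run α x)) (by fun_prop) hEb
  have iE := integrable_exp_run (P := P) hα t
  have iKE : Integrable (fun x => |steinKer α x - 1| * Real.exp (t * run α x)) P := by
    refine integrable_of_abs_le (c := (cK + 1) * Real.exp (t * B)) (by fun_prop) fun x => ?_
    rw [abs_mul, abs_abs]
    have h1 : |steinKer α x - 1| ≤ cK + 1 := by
      have := abs_sub (steinKer α x) 1
      rw [abs_one] at this
      linarith [hcK x]
    exact mul_le_mul h1 (hEb x) (abs_nonneg _) ((abs_nonneg _).trans h1)
  have hpt : ∀ x, ∑' k, weight α k x * discDeriv k (fun x => Real.exp (t * run α x)) x ≤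
      t * Real.exp (t * run α x) + t * (|steinKer α x - 1| * Real.exp (t * run α x)) +
        tiltConst * κ * t ^ 2 * Real.exp (t * run α x) := by
    intro x
    set E := Real.exp (t * run α x)
    have hE : 0 < E := Real.exp_pos _
    have hs := ((summable_weight_mul_grad hα x).mul_left (t * E))
    have herr : ∀ k, |weight α k x * discDeriv k (fun x => Real.exp (t * run α x)) x -
        t * E * (weight α k x * grad α k x)| ≤
        96 * Real.exp 72 * t ^ 2 * E * winSum α k ^ 3 := by
      intro k
      have h1 := abs_discDeriv_exp_sub_le hα ht k (h.mul_winSum_le htκ k) x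
      have h2 := mul_le_mul (hub k x) h1 (abs_nonneg _)
        (mul_nonneg (by norm_num) (winSum_nonneg α k))
      rw [← abs_mul] at h2
      calc _ = |weight α k x * (discDeriv k (fun x => Real.exp (t * run α x)) x -
            t * grad α k x * Real.exp (t * run α x))| := by congr 1; ring
        _ ≤ _ := h2
        _ = _ := by ring
    have hs3 := (h.summable_winSum_pow 2).mul_left (96 * Real.exp 72 * t ^ 2 * E)
    have hsd := summable_of_abs_le hs3 herr
    have e1 : ∑' k, weight α k x * discDeriv k (fun x => Real.exp (t * run α x)) x =
        t * E * steinKer α x +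
        ∑' k, (weight α k x * discDeriv k (fun x => Real.exp (t * run α x)) x -
        t * E * (weight α k x * grad α k x)) := by
      rw [steinKer, ← tsum_mul_left, ← hs.tsum_add hsd]
      exact tsum_congr fun k => by ring
    have h1 := (le_abs_self _).trans (abs_tsum_le hs3 herr)
    have hs3' : ∑' k, 96 * Real.exp 72 * t ^ 2 * E * winSum α k ^ (2 + 1) ≤
        tiltConst * κ * t ^ 2 * E := by
      rw [tsum_mul_left]
      have h3 : ∑' k, winSum α k ^ (2 + 1) ≤ 3321 * κ := h.tsum_winSum_three
      have h4 := mul_le_mul_of_nonneg_left h3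
        (show 0 ≤ 96 * Real.exp 72 * t ^ 2 * E by positivity)
      have h5 : 0 ≤ Real.exp 72 * (κ * t ^ 2 * E) := by positivity
      have h6 : 0 ≤ κ * t ^ 2 * E := by positivity
      unfold tiltConst
      linarith
    have h2 := mul_le_mul_of_nonneg_left (le_abs_self (steinKer α x - 1))
      (show 0 ≤ t * E by positivity)
    rw [e1]
    linarith
  have iSum : Integrable (fun x => t * Real.exp (t * run α x) +
      t * (|steinKer α x - 1| * Real.exp (t * run α x))) P :=
    (iE.const_mul _).add (iKE.const_mul _)
  have hle : ∫ x, run α x * Real.exp (t * run α x) ∂P ≤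
      t * (∫ x, Real.exp (t * run α x) ∂P) +
      t * (∫ x, |steinKer α x - 1| * Real.exp (t * run α x) ∂P) +
      tiltConst * κ * t ^ 2 * ∫ x, Real.exp (t * run α x) ∂P := by
    rw [← integral_const_mul, ← integral_const_mul, ← integral_const_mul,
      ← integral_add (iE.const_mul _) (iKE.const_mul _),
      ← integral_add iSum (iE.const_mul _)]
    refine (le_of_eq ibp).trans ?_
    exact integral_mono (integrable_tsum_mul_discDeriv (summable_weight_bound hα)
      (measurable_weight α) hub (by fun_prop) hEb)
      (iSum.add (iE.const_mul _)) hpt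
  have h1 := mul_le_mul_of_nonneg_left (h.integral_abs_steinKer_sub_one_le hP ht htκ) ht
  linarith

/-- The moment generating function is Gaussian up to a constant factor while `t³ κ ≤ 1`: integrate
the differential inequality of `IsNormalized.integral_run_mul_exp_le`. -/
lemma IsNormalized.integral_exp_le (h : IsNormalized α κ) (hP : FlipInvariant P)
    {t : ℝ} (ht : 0 ≤ t) (hκ1 : κ ≤ 1) (htκ : t ^ 3 * κ ≤ 1) :
    ∫ x, Real.exp (t * run α x) ∂P ≤ Real.exp (2 * tiltConst) * Real.exp (t ^ 2 / 2) := by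
  have hα := h.summable
  have hκ := h.pos
  have hC := tiltConst_pos
  have ht2 : t ^ 2 * κ ≤ 1 := by
    rcases le_or_gt t 1 with h1 | h1
    · have : t ^ 2 ≤ 1 := pow_le_one₀ ht h1
      nlinarith
    · have : t ^ 2 ≤ t ^ 3 := pow_le_pow_right₀ h1.le (by norm_num)
      nlinarith
  have hder : ∀ s, HasDerivAt (fun s => ∫ x, Real.exp (s * run α x) ∂P)
      (∫ x, run α x * Real.exp (s * run α x) ∂P) s := fun s => by
    have hset : integrableExpSet (run α) P = Set.univ :=
      Set.eq_univ_of_forall fun s => integrable_exp_run hα s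
    exact hasDerivAt_mgf (by rw [hset, interior_univ]; trivial)
  set g : ℝ → ℝ := fun s => s ^ 2 / 2 + tiltConst * κ * (s ^ 2 / 2 + 2 * s ^ 3 / 3) with hg
  have hgd : ∀ s, HasDerivAt g (s + tiltConst * κ * (s + 2 * s ^ 2)) s := fun s => by
    have h2 := (hasDerivAt_pow 2 s).div_const 2
    have h3 := ((hasDerivAt_pow 3 s).const_mul 2).div_const 3
    refine (h2.add ((h2.add h3).const_mul (tiltConst * κ))).congr_deriv ?_
    push_cast; ring
  set r : ℝ → ℝ := fun s => (∫ x, Real.exp (s * run α x) ∂P) * Real.exp (-g s) with hr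
  have hrd : ∀ s, HasDerivAt r (((∫ x, run α x * Real.exp (s * run α x) ∂P) -
      (s + tiltConst * κ * (s + 2 * s ^ 2)) * ∫ x, Real.exp (s * run α x) ∂P) *
      Real.exp (-g s)) s := fun s => by
    refine ((hder s).mul (hgd s).neg.exp).congr_deriv ?_
    simp only [Pi.neg_apply]
    ring
  have hanti : AntitoneOn r (Set.Icc 0 t) := by
    refine antitoneOn_of_deriv_nonpos (convex_Icc 0 t)
      (fun s _ => (hrd s).continuousAt.continuousWithinAt)
      (fun s _ => (hrd s).differentiableAt.differentiableWithinAt) fun s hs => ?_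
    rw [interior_Icc] at hs
    rw [(hrd s).deriv]
    refine mul_nonpos_of_nonpos_of_nonneg ?_ (Real.exp_pos _).le
    have hs2 : s ^ 2 ≤ t ^ 2 := pow_le_pow_left₀ hs.1.le hs.2.le 2
    have := h.integral_run_mul_exp_le hP hs.1.le (by nlinarith)
    linarith
  have h1 := hanti ⟨le_rfl, ht⟩ ⟨ht, le_rfl⟩ ht
  have h0 : r 0 = 1 := by simp [hr, hg]
  rw [h0] at h1
  have h2 : ∫ x, Real.exp (t * run α x) ∂P ≤ Real.exp (g t) := by
    have h3 := mul_le_mul_of_nonneg_right h1 (Real.exp_pos (g t)).le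
    have e : r t * Real.exp (g t) = ∫ x, Real.exp (t * run α x) ∂P := by
      simp only [hr]
      rw [mul_assoc, ← Real.exp_add]
      simp
    rw [e, one_mul] at h3
    exact h3
  refine h2.trans ?_
  rw [← Real.exp_add]
  refine Real.exp_le_exp.2 ?_
  have h4 := mul_le_mul_of_nonneg_left ht2 hC.le
  have h5 := mul_le_mul_of_nonneg_left htκ hC.le
  simp only [hg]
  linarith

end

/-! ### The moderate deviation bound on the cube -/

section

variable {P : Measure Cube} [IsProbabilityMeasure P] {α : ℤ → ℝ} {κ : ℝ}

/-- If the tilted first moments of `V` are of order `(1 + t) κ e^{t²/2}`, then the mean of `|V|`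
against the envelope of the Stein solution is of order `(1 + z)³ κ (1 - Φ(z))`. -/
lemma integral_abs_mul_steinEnv_le (hα : Summable fun k => |α k|) {V : Cube → ℝ} {c A z : ℝ}
    (hVm : Measurable V) (hVb : ∀ x, |V x| ≤ c) (hA : 0 ≤ A) (hκ : 0 ≤ κ) (hz : 0 ≤ z)
    (hV : ∀ t, 0 ≤ t → t ≤ z →
      ∫ x, |V x| * Real.exp (t * run α x) ∂P ≤ A * ((1 + t) * κ) * Real.exp (t ^ 2 / 2)) :
    Integrable (fun x => |V x| * steinEnv z (run α x)) P ∧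
    ∫ x, |V x| * steinEnv z (run α x) ∂P ≤
      A * (1 + 6 * √(2 * Real.pi)) * ((1 + z) ^ 3 * κ * (1 - Phi z)) := by
  have hpi := sqrt_two_pi_pos
  have hq := one_sub_Phi_pos z hz
  have hrm := measurable_run hα
  have iV : ∀ t, Integrable (fun x => |V x| * Real.exp (t * run α x)) P := fun t =>
    (integrable_exp_run hα t).bdd_mul hVm.abs.aestronglyMeasurable
      (ae_of_all _ fun x => by rw [Real.norm_eq_abs, abs_abs]; exact hVb x)
  have e : (fun x => |V x| * steinEnv z (run α x)) = fun x =>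
      (1 - Phi z) * (|V x| * Real.exp (0 * run α x)) +
      (1 - Phi z) * √(2 * Real.pi) * (∑ j ∈ Finset.range (⌊z⌋₊ + 1),
        ((j : ℝ) + 1) * Real.exp (1 / 2 - (j : ℝ) ^ 2 / 2) *
          (|V x| * Real.exp (j * run α x))) +
      2 * Real.exp (-z ^ 2) * (|V x| * Real.exp (z * run α x)) := by
    ext x
    have hs : ∑ j ∈ Finset.range (⌊z⌋₊ + 1),
        ((j : ℝ) + 1) * Real.exp (1 / 2 - (j : ℝ) ^ 2 / 2) * (|V x| * Real.exp (j * run α x)) =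
        |V x| * ∑ j ∈ Finset.range (⌊z⌋₊ + 1),
        ((j : ℝ) + 1) * Real.exp (1 / 2 - (j : ℝ) ^ 2 / 2) * Real.exp (j * run α x) := by
      rw [Finset.mul_sum]; exact Finset.sum_congr rfl fun j _ => by ring
    rw [hs, steinEnv, zero_mul, Real.exp_zero]; ring
  have i1 := (iV 0).const_mul (1 - Phi z)
  have i2 : ∀ j ∈ Finset.range (⌊z⌋₊ + 1), Integrable (fun x =>
      ((j : ℝ) + 1) * Real.exp (1 / 2 - (j : ℝ) ^ 2 / 2) *
          (|V x| * Real.exp (j * run α x))) P := fun j _ => (iV j).const_mul _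
  have i2' := (integrable_finsetSum _ i2).const_mul ((1 - Phi z) * √(2 * Real.pi))
  have i3 := (iV z).const_mul (2 * Real.exp (-z ^ 2))
  have i12 : Integrable (fun x => (1 - Phi z) * (|V x| * Real.exp (0 * run α x)) +
      (1 - Phi z) * √(2 * Real.pi) * (∑ j ∈ Finset.range (⌊z⌋₊ + 1),
        ((j : ℝ) + 1) * Real.exp (1 / 2 - (j : ℝ) ^ 2 / 2) *
          (|V x| * Real.exp (j * run α x)))) P := i1.add i2'
  rw [e]
  refine ⟨i12.add i3, ?_⟩
  rw [integral_add i12 i3, integral_add i1 i2', integral_const_mul, integral_const_mul,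
    integral_const_mul, integral_finsetSum _ i2]
  simp_rw [integral_const_mul]
  have hAκ : 0 ≤ A * κ := mul_nonneg hA hκ
  have h0 : ∫ x, |V x| * Real.exp (0 * run α x) ∂P ≤ A * κ := by
    have := hV 0 le_rfl hz
    simpa using this
  have hhalf : Real.exp (1 / 2) ≤ 2 := by
    have h1 := Real.exp_one_lt_d9
    have h2 : Real.exp (1 / 2) * Real.exp (1 / 2) = Real.exp 1 := by
      rw [← Real.exp_add]; norm_num
    nlinarith [Real.exp_pos (1 / 2)]
  have hsum : ∑ j ∈ Finset.range (⌊z⌋₊ + 1), ((j : ℝ) + 1) * Real.exp (1 / 2 - (j : ℝ) ^ 2 / 2) *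
      ∫ x, |V x| * Real.exp (j * run α x) ∂P ≤ 2 * (A * κ) * (1 + z) ^ 3 := by
    have hn : ((⌊z⌋₊ : ℝ) + 1) ≤ 1 + z := by linarith [Nat.floor_le hz]
    have hterm : ∀ j ∈ Finset.range (⌊z⌋₊ + 1),
        ((j : ℝ) + 1) * Real.exp (1 / 2 - (j : ℝ) ^ 2 / 2) *
        ∫ x, |V x| * Real.exp (j * run α x) ∂P ≤ 2 * (A * κ) * (1 + z) ^ 2 := by
      intro j hj
      have hjn : j ≤ ⌊z⌋₊ := Nat.lt_succ_iff.1 (Finset.mem_range.1 hj)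
      have hjz : (j : ℝ) ≤ z := (Nat.cast_le.2 hjn).trans (Nat.floor_le hz)
      have hj0 : (0 : ℝ) ≤ j := Nat.cast_nonneg j
      have h1 := mul_le_mul_of_nonneg_left (hV j hj0 hjz)
        (show 0 ≤ ((j : ℝ) + 1) * Real.exp (1 / 2 - (j : ℝ) ^ 2 / 2) by positivity)
      have h2 : Real.exp (1 / 2 - (j : ℝ) ^ 2 / 2) * Real.exp ((j : ℝ) ^ 2 / 2) =
          Real.exp (1 / 2) := by
        rw [← Real.exp_add]; ring_nf
      have h3 : ((j : ℝ) + 1) * Real.exp (1 / 2 - (j : ℝ) ^ 2 / 2) *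
          (A * ((1 + j) * κ) * Real.exp ((j : ℝ) ^ 2 / 2)) =
          A * κ * ((1 + j) ^ 2 * Real.exp (1 / 2)) := by
        rw [← h2]; ring
      rw [h3] at h1
      have h4 : (1 + (j : ℝ)) ^ 2 ≤ (1 + z) ^ 2 := pow_le_pow_left₀ (by positivity) (by linarith) 2
      have h5 := mul_le_mul h4 hhalf (Real.exp_pos _).le (by positivity)
      have h6 := mul_le_mul_of_nonneg_left h5 hAκ
      linarith
    refine (Finset.sum_le_sum hterm).trans ?_
    rw [Finset.sum_const, Finset.card_range, nsmul_eq_mul]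
    push_cast
    have := mul_le_mul_of_nonneg_right hn (show 0 ≤ 2 * (A * κ) * (1 + z) ^ 2 by positivity)
    linarith
  have h3 : 2 * Real.exp (-z ^ 2) * ∫ x, |V x| * Real.exp (z * run α x) ∂P ≤
      4 * √(2 * Real.pi) * (A * κ) * (1 + z) ^ 3 * (1 - Phi z) := by
    have h1 := mul_le_mul_of_nonneg_left (hV z hz le_rfl)
      (show 0 ≤ 2 * Real.exp (-z ^ 2) by positivity)
    have h2 : Real.exp (-z ^ 2) * Real.exp (z ^ 2 / 2) = Real.exp (-z ^ 2 / 2) := by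
      rw [← Real.exp_add]; ring_nf
    have h3 : 2 * Real.exp (-z ^ 2) * (A * ((1 + z) * κ) * Real.exp (z ^ 2 / 2)) =
        2 * (A * κ) * (1 + z) * Real.exp (-z ^ 2 / 2) := by rw [← h2]; ring
    rw [h3] at h1
    have h4 := mul_le_mul_of_nonneg_left (exp_le_one_sub_Phi hz)
      (show 0 ≤ 2 * (A * κ) * (1 + z) by positivity)
    have h5 : (1 + z) ^ 2 ≤ (1 + z) ^ 3 := pow_le_pow_right₀ (by linarith) (by norm_num)
    have h6 := mul_le_mul_of_nonneg_left h5
      (show 0 ≤ 4 * √(2 * Real.pi) * (A * κ) * (1 - Phi z) by positivity)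
    linarith
  have h4 := mul_le_mul_of_nonneg_left h0 hq.le
  have h5 := mul_le_mul_of_nonneg_left hsum (mul_pos hq hpi).le
  have h6 : 1 ≤ (1 + z) ^ 3 := one_le_pow₀ (by linarith)
  have h7 := mul_le_mul_of_nonneg_left h6 (mul_nonneg hq.le hAκ)
  linarith

lemma measurable_steinDeriv (z : ℝ) : Measurable (steinDeriv z) :=
  ((measurable_id.mul (continuous_steinSol z).measurable).add
    (Measurable.ite measurableSet_Iic measurable_const measurable_const)).sub measurable_const

lemma measurable_steinMono (z : ℝ) : Measurable (steinMono z) :=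
  (measurable_id.mul (continuous_steinSol z).measurable).add
    (Measurable.ite measurableSet_Ioi measurable_const measurable_const)

lemma exists_abs_steinSol_le (z B : ℝ) : ∃ c, ∀ s, |s| ≤ B →
    |steinSol z s| ≤ c ∧ |steinDeriv z s| ≤ c ∧ |steinMono z s| ≤ c := by
  obtain ⟨c, hc⟩ := (isCompact_Icc (a := -B) (b := B)).exists_bound_of_continuousOn
    (continuous_steinSol z).continuousOn
  obtain ⟨c', hc'⟩ := (isCompact_Icc (a := -B) (b := B)).exists_bound_of_continuousOn
    (continuous_id.mul (continuous_steinSol z)).continuousOn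
  refine ⟨|c| + |c'| + 2, fun s hs => ?_⟩
  have h1 := hc s (abs_le.1 hs)
  have h2 := hc' s (abs_le.1 hs)
  simp only [Pi.mul_apply, id, Real.norm_eq_abs] at h1 h2
  have h3 := le_abs_self c
  have h4 := le_abs_self c'
  have h5 := abs_nonneg c
  have h6 := abs_nonneg c'
  have h7 := Phi_nonneg z
  have h8 := Phi_le_one z
  rw [abs_le] at h1 h2
  unfold steinDeriv steinMono
  refine ⟨abs_le.2 ⟨by linarith, by linarith⟩, ?_, ?_⟩ <;> rw [abs_le] <;> split_ifs <;>
    constructor <;> linarith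

/-- The discrete chain rule for the Stein solution, with the error expressed through the discrete
derivative of a monotone function of the 2-run. -/
lemma abs_discDeriv_steinSol_sub_le (hα : Summable fun k => |α k|) (z : ℝ) (k : ℤ) (x : Cube) :
    |discDeriv k (fun x => steinSol z (run α x)) x - grad α k x * steinDeriv z (run α x)| ≤
      2 * (grad α k x * discDeriv k (fun x => steinMono z (run α x)) x) := by
  have h := abs_steinSol_sub_le z (run α x) (run α (flip k x))
  rw [← discDeriv_run hα]
  unfold discDeriv
  have e1 : sgn k x * (steinSol z (run α x) - steinSol z (run α (flip k x))) / 2 -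
      sgn k x * (run α x - run α (flip k x)) / 2 * steinDeriv z (run α x) =
      sgn k x * ((steinSol z (run α x) - steinSol z (run α (flip k x)) -
        (run α x - run α (flip k x)) * steinDeriv z (run α x)) / 2) := by ring
  rw [e1, abs_mul, abs_sgn, one_mul, abs_div, abs_two]
  have e2 : 2 * (sgn k x * (run α x - run α (flip k x)) / 2 *
      (sgn k x * (steinMono z (run α x) - steinMono z (run α (flip k x))) / 2)) =
      (run α x - run α (flip k x)) *
        (steinMono z (run α x) - steinMono z (run α (flip k x))) / 2 := by
    linear_combination (run α x - run α (flip k x)) *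
        (steinMono z (run α x) - steinMono z (run α (flip k x))) / 2 * sgn_sq k x
  rw [e2]
  linarith

/-- Stein's identity: integration by parts reduces the error of the normal approximation to the
fluctuation of the Stein kernel and to `E[g(W) Y]`, where `g` is `steinMono` and `Y` is `errDiv`. -/
lemma abs_tail_sub_le (hα : Summable fun k => |α k|) (hP : FlipInvariant P) {z : ℝ} (hz : 0 ≤ z)
    (hi1 : Integrable (fun x => |steinKer α x - 1| * steinEnv z (run α x)) P)
    (hi2 : Integrable (fun x => |errDiv α x| * steinEnv z (run α x)) P) :
    |P.real {x | z < run α x} - (1 - Phi z)| ≤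
      (∫ x, |steinKer α x - 1| * steinEnv z (run α x) ∂P) +
      2 * ∫ x, |errDiv α x| * steinEnv z (run α x) ∂P := by
  have hrm := measurable_run hα
  set B := ∑' k, 3 * winSum α k
  obtain ⟨c, hc⟩ := exists_abs_steinSol_le z B
  have hcx : ∀ x, _ := fun x => hc (run α x) (abs_run_le hα x)
  have hfm : Measurable fun x => steinSol z (run α x) :=
    (continuous_steinSol z).measurable.comp hrm
  have hpm : Measurable fun x => steinDeriv z (run α x) := (measurable_steinDeriv z).comp hrm
  have hgm : Measurable fun x => steinMono z (run α x) := (measurable_steinMono z).comp hrm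
  have hub : ∀ k x, |weight α k x| ≤ 3 * winSum α k := fun k x =>
    abs_weight_le (abs_le_winSum_of_near α) x
  have hvb : ∀ k x, |(|weight α k x| * grad α k x)| ≤ 12 * winSum α k ^ 2 := fun k x =>
    abs_weight_mul_grad_le (abs_le_winSum_of_near α) x
  have hvs : Summable fun k => 12 * winSum α k ^ 2 :=
    (summable_pow_succ (summable_winSum hα) (winSum_nonneg α) 1).mul_left 12
  have hvm : ∀ k, Measurable fun x => |weight α k x| * grad α k x := fun k =>
    (measurable_weight α k).abs.mul (measurable_grad α k)
  have ibp1 := integral_tsum_sgn_mul hP (summable_weight_bound hα) (measurable_weight α) hub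
    (weight_flip_self α) hfm fun x => (hcx x).1
  have ibp2 := integral_tsum_sgn_mul hP hvs hvm hvb
    (fun k x => by rw [weight_flip_self, grad_flip_self]) hgm fun x => (hcx x).2.2
  have iI := integrable_tsum_mul_discDeriv (P := P) (summable_weight_bound hα)
    (measurable_weight α) hub hfm fun x => (hcx x).1
  have iJ := integrable_tsum_mul_discDeriv (P := P) hvs hvm hvb hgm fun x => (hcx x).2.2
  have ip : Integrable (fun x => steinDeriv z (run α x)) P :=
    integrable_of_abs_le hpm fun x => (hcx x).2.1
  set I : Cube → ℝ := fun x =>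
    ∑' k, weight α k x * discDeriv k (fun x => steinSol z (run α x)) x with hI
  set J : Cube → ℝ := fun x =>
    ∑' k, |weight α k x| * grad α k x * discDeriv k (fun x => steinMono z (run α x)) x with hJ
  have hms : MeasurableSet {x | z < run α x} := measurableSet_lt measurable_const hrm
  have hstein : (1 - Phi z) - P.real {x | z < run α x} =
      ∫ x, (steinDeriv z (run α x) - I x) ∂P := by
    have iW : Integrable (fun x => run α x * steinSol z (run α x)) P := by
      refine integrable_of_abs_le (c := B * c) (by fun_prop) fun x => ?_
      rw [abs_mul]
      exact mul_le_mul (abs_run_le hα x) (hcx x).1 (abs_nonneg _)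
        ((abs_nonneg _).trans (abs_run_le hα x))
    have e1 : ∫ x, I x ∂P = ∫ x, run α x * steinSol z (run α x) ∂P := ibp1.symm
    rw [integral_sub ip iI, e1, ← integral_sub ip iW]
    have e2 : (fun x => steinDeriv z (run α x) - run α x * steinSol z (run α x)) =
        fun x => (1 - Phi z) - {x | z < run α x}.indicator (fun _ => (1 : ℝ)) x := by
      ext x
      rw [steinDeriv_eq]
      simp only [Set.indicator, Set.mem_ofPred_eq]
      ring
    rw [e2, integral_sub (integrable_const _)
      ((integrable_const (1 : ℝ)).indicator hms), integral_indicator_const _ hms]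
    simp
  have hIJ : ∀ x, |steinDeriv z (run α x) - I x| ≤
      |steinKer α x - 1| * steinEnv z (run α x) + 2 * J x := by
    intro x
    have hsJ : Summable fun k =>
        2 * (|weight α k x| * grad α k x * discDeriv k (fun x => steinMono z (run α x)) x) := by
      refine (summable_of_abs_le (hvs.mul_right c) fun k => ?_).mul_left 2
      rw [abs_mul]
      exact mul_le_mul (hvb k x) (abs_discDeriv_le k (fun x => (hcx x).2.2) x) (abs_nonneg _)
        ((abs_nonneg _).trans (hvb k x))
    have hterm : ∀ k, |weight α k x * discDeriv k (fun x => steinSol z (run α x)) x -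
        weight α k x * grad α k x * steinDeriv z (run α x)| ≤
        2 * (|weight α k x| * grad α k x *
          discDeriv k (fun x => steinMono z (run α x)) x) := by
      intro k
      have := mul_le_mul_of_nonneg_left (abs_discDeriv_steinSol_sub_le hα z k x)
        (abs_nonneg (weight α k x))
      rw [← abs_mul] at this
      calc _ = |weight α k x * (discDeriv k (fun x => steinSol z (run α x)) x -
            grad α k x * steinDeriv z (run α x))| := by congr 1; ring
        _ ≤ _ := this
        _ = _ := by ring
    have hsd := summable_of_abs_le hsJ hterm
    have hsw := (summable_weight_mul_grad hα x).mul_right (steinDeriv z (run α x))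
    have e1 : I x = steinKer α x * steinDeriv z (run α x) +
        ∑' k, (weight α k x * discDeriv k (fun x => steinSol z (run α x)) x -
        weight α k x * grad α k x * steinDeriv z (run α x)) := by
      rw [hI, steinKer, ← tsum_mul_right, ← hsw.tsum_add hsd]
      exact tsum_congr fun k => by ring
    have h1 := abs_tsum_le hsJ hterm
    rw [tsum_mul_left] at h1
    have h2 : |(steinKer α x - 1) * steinDeriv z (run α x)| ≤
        |steinKer α x - 1| * steinEnv z (run α x) := by
      rw [abs_mul]
      exact mul_le_mul_of_nonneg_left (stein_bounds hz _).1 (abs_nonneg _)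
    have e3 : steinDeriv z (run α x) - I x = -((steinKer α x - 1) * steinDeriv z (run α x)) -
        ∑' k, (weight α k x * discDeriv k (fun x => steinSol z (run α x)) x -
        weight α k x * grad α k x * steinDeriv z (run α x)) := by rw [e1]; ring
    rw [e3]
    refine (abs_sub _ _).trans ?_
    rw [abs_neg]
    exact add_le_add h2 h1
  have hJle : ∫ x, J x ∂P ≤ ∫ x, |errDiv α x| * steinEnv z (run α x) ∂P := by
    rw [hJ, ← ibp2]
    refine integral_mono ?_ hi2 fun x => ?_
    · refine integrable_of_abs_le (c := (∑' k, 12 * winSum α k ^ 2) * c) ?_ fun x => ?_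
      · exact (measurable_tsum_of_le
          (f := fun k x => sgn k x * (|weight α k x| * grad α k x)) hvs (fun k => (measurable_sgn k).mul (hvm k)) fun k x => by
          rw [abs_mul, abs_sgn, one_mul]; exact hvb k x).mul hgm
      · have h1 := abs_tsum_le hvs (f := fun k => sgn k x * (|weight α k x| * grad α k x))
          fun k => by rw [abs_mul, abs_sgn, one_mul]; exact hvb k x
        rw [abs_mul]
        exact mul_le_mul h1 (hcx x).2.2 (abs_nonneg _) ((abs_nonneg _).trans h1)
    · refine (le_abs_self _).trans ?_
      dsimp only
      rw [abs_mul]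
      exact mul_le_mul_of_nonneg_left (stein_bounds hz _).2 (abs_nonneg _)
  rw [abs_sub_comm, hstein]
  calc |∫ x, (steinDeriv z (run α x) - I x) ∂P|
      ≤ ∫ x, |steinDeriv z (run α x) - I x| ∂P := abs_integral_le_integral_abs
    _ ≤ ∫ x, (|steinKer α x - 1| * steinEnv z (run α x) + 2 * J x) ∂P :=
        integral_mono (ip.sub iI).abs (hi1.add (iJ.const_mul 2)) hIJ
    _ = (∫ x, |steinKer α x - 1| * steinEnv z (run α x) ∂P) + 2 * ∫ x, J x ∂P := by
        rw [integral_add hi1 (iJ.const_mul 2), integral_const_mul]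
    _ ≤ _ := by linarith

/-- The constant in the moderate deviation bound for normalized 2-runs. -/
noncomputable def tailConst : ℝ :=
  3 * (tiltConst * Real.exp (2 * tiltConst) * (1 + 6 * √(2 * Real.pi)))

lemma tailConst_pos : 0 < tailConst := by
  have := tiltConst_pos
  unfold tailConst
  positivity

/-- The moderate deviation bound for normalized 2-runs, with relative error `O((1 + z)³ κ)`. -/
lemma IsNormalized.abs_tail_sub_le (h : IsNormalized α κ) (hP : FlipInvariant P) {z : ℝ}
    (hz : 0 ≤ z) (hκ1 : κ ≤ 1) (hzκ : z ^ 3 * κ ≤ 1) :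
    |P.real {x | z < run α x} - (1 - Phi z)| ≤
      tailConst * ((1 + z) ^ 3 * κ * (1 - Phi z)) := by
  have hα := h.summable
  have hκ := h.pos
  have hC := tiltConst_pos
  have hz2 : z ^ 2 * κ ≤ 1 := by
    rcases le_or_gt z 1 with h1 | h1
    · have : z ^ 2 ≤ 1 := pow_le_one₀ hz h1
      nlinarith
    · have : z ^ 2 ≤ z ^ 3 := pow_le_pow_right₀ h1.le (by norm_num)
      nlinarith
  have htilt : ∀ V : Cube → ℝ, (∀ t, 0 ≤ t → t ^ 2 * κ ≤ 1 →
      ∫ x, |V x| * Real.exp (t * run α x) ∂P ≤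
        tiltConst * ((1 + t) * κ) * ∫ x, Real.exp (t * run α x) ∂P) →
      ∀ t, 0 ≤ t → t ≤ z → ∫ x, |V x| * Real.exp (t * run α x) ∂P ≤
        tiltConst * Real.exp (2 * tiltConst) * ((1 + t) * κ) * Real.exp (t ^ 2 / 2) := by
    intro V hV t ht htz
    have h2 : t ^ 2 ≤ z ^ 2 := pow_le_pow_left₀ ht htz 2
    have h3 : t ^ 3 ≤ z ^ 3 := pow_le_pow_left₀ ht htz 3
    have h4 := h.integral_exp_le hP ht hκ1 (by nlinarith)
    have h5 := mul_le_mul_of_nonneg_left h4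
      (show 0 ≤ tiltConst * ((1 + t) * κ) by positivity)
    have h6 := hV t ht (by nlinarith)
    linarith
  obtain ⟨cK, hcK⟩ := exists_abs_steinKer_le hα
  have hvb : ∀ k x, |sgn k x * (|weight α k x| * grad α k x)| ≤ 12 * winSum α k ^ 2 :=
    fun k x => by
      rw [abs_mul, abs_sgn, one_mul]
      exact abs_weight_mul_grad_le (abs_le_winSum_of_near α) x
  have hvs : Summable fun k => 12 * winSum α k ^ 2 := (h.summable_winSum_pow 1).mul_left 12
  have h1 := integral_abs_mul_steinEnv_le (P := P) hα (V := fun x => steinKer α x - 1)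
    (c := cK + 1) ((measurable_steinKer hα).sub_const 1) (fun x => by
      have := abs_sub (steinKer α x) 1
      rw [abs_one] at this
      linarith [hcK x]) (by positivity) hκ.le hz
    (htilt _ fun t ht ht2 => h.integral_abs_steinKer_sub_one_le hP ht ht2)
  have h2 := integral_abs_mul_steinEnv_le (P := P) hα (V := errDiv α)
    (measurable_tsum_of_le hvs (fun k => (measurable_sgn k).mul
      ((measurable_weight α k).abs.mul (measurable_grad α k))) hvb)
    (fun x => abs_tsum_le hvs fun k => hvb k x) (by positivity) hκ.le hz
    (htilt _ fun t ht ht2 => h.integral_abs_errDiv_le hP ht ht2)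
  have h3 := TwoRuns.abs_tail_sub_le hα hP hz h1.1 h2.1
  unfold tailConst
  linarith [h1.2, h2.2]

end

/-! ### Transfer from Rademacher sequences to the cube -/

/-- The point of the cube that records which `X_i` equal `1`. -/
noncomputable def signs {Ω : Type*} (X : ℤ → Ω → ℝ) (ω : Ω) : Cube :=
  open Classical in fun i => decide (X i ω = 1)

section Moments

variable {P : Measure Cube} [IsProbabilityMeasure P] {a : ℤ → ℝ}

lemma run_const_mul (c : ℝ) (a : ℤ → ℝ) (x : Cube) :
    run (fun k => c * a k) x = c * run a x := by
  rw [run, run, ← tsum_mul_left]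
  exact tsum_congr fun k => by unfold weight; ring

lemma integral_tsum_sgn_eq_zero (hP : FlipInvariant P) {w : ℤ → Cube → ℝ} {b : ℤ → ℝ}
    (hb : Summable b) (hwm : ∀ k, Measurable (w k)) (hw : ∀ k x, |w k x| ≤ b k)
    (hinv : ∀ k x, w k (flip k x) = w k x) : ∫ x, ∑' k, sgn k x * w k x ∂P = 0 := by
  have := integral_tsum_sgn_mul hP hb hwm hw hinv (h := fun _ => 1) (c := 1) measurable_const
    (by simp)
  simpa [discDeriv] using this

lemma integral_run (hP : FlipInvariant P) (ha : Summable fun k => |a k|) :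
    ∫ x, run a x ∂P = 0 :=
  integral_tsum_sgn_eq_zero hP (summable_weight_bound ha) (measurable_weight a)
    (fun _ x => abs_weight_le (abs_le_winSum_of_near a) x) (weight_flip_self a)

lemma integral_run_sq (hP : FlipInvariant P) (ha : Summable fun k => |a k|) :
    ∫ x, run a x ^ 2 ∂P = ∑' k, ((a (k - 1) + a k) ^ 2 + a k ^ 2) := by
  have h := integral_tsum_sgn_mul hP (summable_weight_bound ha) (measurable_weight a)
    (fun _ x => abs_weight_le (abs_le_winSum_of_near a) x) (weight_flip_self a)
    (measurable_run ha) (abs_run_le ha)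
  have hs : Summable fun k => 12 * winSum a k ^ 2 :=
    (summable_pow_succ (summable_winSum ha) (winSum_nonneg a) 1).mul_left 12
  have hb : ∀ k x, |kerWeight a k x| ≤ 12 * winSum a k ^ 2 := fun k x =>
    abs_kerWeight_le (abs_le_winSum_of_near a) x
  have hb' : ∀ k x, |sgn k x * kerWeight a k x| ≤ 12 * winSum a k ^ 2 := fun k x => by
    rw [abs_mul, abs_sgn, one_mul]; exact hb k x
  have e : ∀ x, ∑' k, weight a k x * discDeriv k (run a) x =
      ∑' k, ((a (k - 1) + a k) ^ 2 + a k ^ 2) + ∑' k, sgn k x * kerWeight a k x := fun x => by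
    rw [← steinKer_eq ha, steinKer]
    exact tsum_congr fun k => by rw [discDeriv_run ha]
  simp_rw [e] at h
  rw [integral_add (integrable_const _) (integrable_of_abs_le
    (measurable_tsum_of_le hs (fun k => by fun_prop) hb')
    fun x => abs_tsum_le hs fun k => hb' k x),
    integral_tsum_sgn_eq_zero hP hs (measurable_kerWeight a) hb (kerWeight_flip_self a)] at h
  simp_rw [sq (run a _)]
  rw [show (fun x => run a x * run a x) = fun x => (∑' k, sgn k x * weight a k x) * run a x
    from rfl, h]
  simp

end Moments

section Transfer

variable {Ω : Type*} [MeasurableSpace Ω] {μ : Measure Ω} {X : ℤ → Ω → ℝ} {a : ℤ → ℝ}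

lemma measurable_decide_eq_one : Measurable fun y : ℝ => (open Classical in decide (y = 1)) :=
  measurable_to_bool (by
    have : (fun y : ℝ => (open Classical in decide (y = 1))) ⁻¹' {true} = {1} := by ext; simp
    rw [this]
    exact measurableSet_singleton 1)

lemma IsRademacherSequence.measurable_signs (h : IsRademacherSequence μ X) :
    Measurable (signs X) :=
  measurable_pi_lambda _ fun i => measurable_decide_eq_one.comp (h.measurable i)

lemma le_gamma {c z : ℝ} (hC : 0 ≤ C μ X a) (hc : 0 ≤ c) (hz : 0 ≤ z) :
    (1 + z) * C μ X a ≤ gamma μ X a c z := by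
  have h1 : 1 ≤ Real.exp (c * z * variance (G X a) μ ^ (-(1 / 2) : ℝ)) :=
    Real.one_le_exp (mul_nonneg (mul_nonneg hc hz)
      (Real.rpow_nonneg (variance_nonneg _ _) _))
  have h2 : 0 ≤ z ^ (1 / 2 : ℝ) * C μ X a ^ (1 / 2 : ℝ) := by positivity
  have h3 : 0 ≤ z ^ (1 / 2 : ℝ) * C μ X a := by positivity
  have h4 : (1 + z) * C μ X a ≤
      z ^ (1 / 2 : ℝ) * C μ X a ^ (1 / 2 : ℝ) + (1 + z ^ (1 / 2 : ℝ) + z) * C μ X a := by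
    linarith
  have h5 : 0 ≤ (1 + z) * C μ X a := by positivity
  exact h4.trans (le_mul_of_one_le_left (h5.trans h4) h1)

lemma pow_three_mul_C_le (hC : 0 < C μ X a) {z : ℝ} (hz : 0 ≤ z) (hr : z ≤ range μ X a) :
    z ^ 3 * C μ X a ≤ 1 := by
  have h1 : z ≤ C μ X a ^ (-(1 / 3) : ℝ) :=
    hr.trans ((min_le_left _ _).trans (min_le_right _ _))
  have h2 := pow_le_pow_left₀ hz h1 3
  have h3 : (C μ X a ^ (-(1 / 3) : ℝ)) ^ 3 = (C μ X a)⁻¹ := by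
    rw [← Real.rpow_natCast, ← Real.rpow_mul hC.le]
    norm_num [Real.rpow_neg_one]
  rw [h3] at h2
  have h4 := mul_le_mul_of_nonneg_right h2 hC.le
  rwa [inv_mul_cancel₀ hC.ne'] at h4

variable [IsProbabilityMeasure μ]

lemma IsRademacherSequence.ae_eq_sgn (h : IsRademacherSequence μ X) :
    ∀ᵐ ω ∂μ, ∀ i, X i ω = sgn i (signs X ω) := by
  rw [ae_all_iff]
  intro i
  have hm1 : MeasurableSet {ω | X i ω = 1} := h.measurable i (measurableSet_singleton 1)
  have hm2 : MeasurableSet {ω | X i ω = -1} := h.measurable i (measurableSet_singleton (-1))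
  have hdisj : Disjoint {ω | X i ω = 1} {ω | X i ω = -1} := by
    rw [Set.disjoint_left]
    intro ω h1 h2
    have h1 : X i ω = 1 := h1
    have h2 : X i ω = -1 := h2
    linarith
  have hu : μ ({ω | X i ω = 1} ∪ {ω | X i ω = -1}) = 1 := by
    rw [measure_union hdisj hm2, h.prob_one, h.prob_neg_one, ENNReal.add_halves]
  have := (prob_compl_eq_zero_iff (hm1.union hm2)).2 hu
  filter_upwards [compl_mem_ae_iff.2 this] with ω hω
  rw [compl_compl] at hω
  rcases hω with h1 | h1
  · have h1 : X i ω = 1 := h1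
    simp [sgn, signs, h1]
  · have h1 : X i ω = -1 := h1
    have : ¬ ((-1 : ℝ) = 1) := by norm_num
    simp [sgn, signs, h1, this]

lemma IsRademacherSequence.flipInvariant (h : IsRademacherSequence μ X) :
    FlipInvariant (μ.map (signs X)) := by
  intro k
  refine ⟨measurable_flip k, ?_⟩
  set B : ℤ → Ω → Bool := fun i ω => signs X ω i with hB
  have hBm : ∀ i, Measurable (B i) := fun i => measurable_decide_eq_one.comp (h.measurable i)
  have hBi : iIndepFun B μ := h.indep.comp _ fun _ => measurable_decide_eq_one
  have hlaw : μ.map (signs X) = Measure.infinitePi fun i => μ.map (B i) :=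
    hBi.map_fun_eq_infinitePi_map hBm
  have hprob : ∀ i, IsProbabilityMeasure (μ.map (B i)) := fun i =>
    Measure.isProbabilityMeasure_map (hBm i).aemeasurable
  set f : ℤ → Bool → Bool := fun i b => if i = k then !b else b with hf
  have hflip : flip k = fun x i => f i (x i) := by
    ext x i
    by_cases hi : i = k
    · subst hi; simp [flip, hf]
    · simp [flip, hf, hi]
  rw [hlaw, hflip, Measure.infinitePi_map_pi _ fun i => measurable_of_countable _]
  congr 1
  ext1 i
  by_cases hi : i = k
  · have ht : μ (B i ⁻¹' {true}) = 1 / 2 := by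
      rw [← h.prob_one i]; congr 1; ext ω; simp [hB, signs]
    have hfl : μ (B i ⁻¹' {false}) = 1 / 2 := by
      have : B i ⁻¹' {false} = (B i ⁻¹' {true})ᶜ := by ext ω; simp
      rw [this, prob_compl_eq_one_sub (hBm i (measurableSet_singleton true)), ht]
      simp
    have hnot : f i = fun b => !b := by ext b; simp [hf, hi]
    rw [hnot]
    refine Measure.ext_of_singleton fun b => ?_
    rw [Measure.map_apply (measurable_of_countable _) (measurableSet_singleton b),
      Measure.map_apply (hBm i) (measurableSet_singleton b),
      Measure.map_apply (hBm i) (measurable_of_countable _ (measurableSet_singleton b))]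
    have e : (fun b => !b) ⁻¹' {b} = {!b} := by ext c; cases b <;> cases c <;> simp
    rw [e]
    cases b
    · exact ht.trans hfl.symm
    · exact hfl.trans ht.symm
  · have hid : f i = id := by ext b; simp [hf, hi]
    rw [hid, Measure.map_id]

lemma IsRademacherSequence.G_ae_eq (h : IsRademacherSequence μ X)
    (ha : Summable fun k => |a k|) :
    ∀ᵐ ω ∂μ, G X a ω = 1 / 4 * run a (signs X ω) + ∑' k, a k / 4 := by
  filter_upwards [h.ae_eq_sgn] with ω hω
  set x := signs X ω
  have ha' : Summable a := ha.of_abs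
  have s1 : Summable fun k => a k * sgn (k + 1) x / 4 :=
    summable_of_abs_le (b := fun k => |a k|) ha fun k => by
      rw [abs_div, abs_mul, abs_sgn, mul_one, abs_of_pos (by norm_num : (0 : ℝ) < 4)]
      linarith [abs_nonneg (a k)]
  have s2 : Summable fun k => sgn k x * (a k + a k * sgn (k + 1) x) / 4 :=
    summable_of_abs_le (b := fun k => |a k|) ha fun k => by
      have h1 := abs_add_le (a k) (a k * sgn (k + 1) x)
      rw [abs_mul (a k), abs_sgn, mul_one] at h1
      rw [abs_div, abs_mul, abs_sgn, one_mul, abs_of_pos (by norm_num : (0 : ℝ) < 4)]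
      linarith [abs_nonneg (a k)]
  have e1 : ∑' k, a (k - 1) * sgn k x / 4 = ∑' k, a k * sgn (k + 1) x / 4 := by
    rw [← tsum_comp_add (fun k => a k * sgn (k + 1) x / 4) (-1)]
    exact tsum_congr fun k => by rw [← sub_eq_add_neg, sub_add_cancel]
  have s1' : Summable fun k => a (k - 1) * sgn k x / 4 := by
    refine (summable_comp_add s1 (-1)).congr fun k => ?_
    rw [← sub_eq_add_neg, sub_add_cancel]
  have e2 : 1 / 4 * run a x = ∑' k, a (k - 1) * sgn k x / 4 +
      ∑' k, sgn k x * (a k + a k * sgn (k + 1) x) / 4 := by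
    rw [run, ← tsum_mul_left, ← s1'.tsum_add s2]
    exact tsum_congr fun k => by unfold weight; ring
  rw [e2, e1, ← s1.tsum_add s2, ← (s1.add s2).tsum_add (ha'.div_const 4), G]
  refine tsum_congr fun k => ?_
  rw [xi, xi, hω k, hω (k + 1)]
  ring

lemma IsRademacherSequence.integral_G (h : IsRademacherSequence μ X)
    (ha : Summable fun k => |a k|) : ∫ ω, G X a ω ∂μ = ∑' k, a k / 4 := by
  have hP := h.flipInvariant
  have hsm := h.measurable_signs
  have := Measure.isProbabilityMeasure_map (μ := μ) hsm.aemeasurable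
  have hrm := measurable_run ha
  have h0 : ∫ ω, run a (signs X ω) ∂μ = 0 := by
    rw [← integral_map hsm.aemeasurable hrm.aestronglyMeasurable]
    exact integral_run hP ha
  have hi : Integrable (fun ω => run a (signs X ω)) μ :=
    Integrable.of_bound (hrm.comp hsm).aestronglyMeasurable _ (ae_of_all _ fun ω => abs_run_le ha _)
  rw [integral_congr_ae (h.G_ae_eq ha), integral_add (hi.const_mul _) (integrable_const _),
    integral_const_mul, h0]
  simp

lemma IsRademacherSequence.variance_G (h : IsRademacherSequence μ X)
    (ha : Summable fun k => |a k|) :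
    variance (G X a) μ = (∑' k, ((a (k - 1) + a k) ^ 2 + a k ^ 2)) / 16 := by
  have hP := h.flipInvariant
  have hsm := h.measurable_signs
  have := Measure.isProbabilityMeasure_map (μ := μ) hsm.aemeasurable
  have hrm := measurable_run ha
  have hGm : AEMeasurable (G X a) μ :=
    ⟨fun ω => 1 / 4 * run a (signs X ω) + ∑' k, a k / 4,
      ((hrm.comp hsm).const_mul _).add_const _, h.G_ae_eq ha⟩
  rw [variance_eq_integral hGm, h.integral_G ha]
  have e : ∀ᵐ ω ∂μ, (G X a ω - ∑' k, a k / 4) ^ 2 = 1 / 16 * run a (signs X ω) ^ 2 := by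
    filter_upwards [h.G_ae_eq ha] with ω hω
    rw [hω]; ring
  rw [integral_congr_ae e, integral_const_mul,
    ← integral_map (f := fun x => run a x ^ 2) hsm.aemeasurable
      (hrm.pow_const 2).aestronglyMeasurable, integral_run_sq hP ha]
  ring

lemma variance_terms_pos (ha : Summable fun k => |a k|) (ha0 : a ≠ 0) :
    0 < ∑' k, ((a (k - 1) + a k) ^ 2 + a k ^ 2) := by
  obtain ⟨k, hk⟩ := Function.ne_iff.1 ha0
  have hk : a k ≠ 0 := hk
  have := (summable_variance_terms ha).le_tsum k fun j _ => by positivity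
  have h2 : 0 < a k ^ 2 := by positivity
  nlinarith [sq_nonneg (a (k - 1) + a k)]

lemma IsRademacherSequence.variance_G_pos (h : IsRademacherSequence μ X)
    (ha : Summable fun k => |a k|) (ha0 : a ≠ 0) : 0 < variance (G X a) μ := by
  rw [h.variance_G ha]
  exact div_pos (variance_terms_pos ha ha0) (by norm_num)

lemma lpNorm_four_sq (a : ℤ → ℝ) : lpNorm 4 a ^ 2 = √(∑' k, |a k| ^ 4) := by
  have h0 : 0 ≤ ∑' k, |a k| ^ 4 := tsum_nonneg fun _ => by positivity
  have e : ∑' k, |a k| ^ (4 : ℝ) = ∑' k, |a k| ^ 4 := tsum_congr fun k => by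
    rw [← Real.rpow_natCast]; norm_num
  rw [lpNorm, e, ← Real.rpow_natCast, ← Real.rpow_mul h0, Real.sqrt_eq_rpow]
  norm_num

lemma IsRademacherSequence.C_pos (h : IsRademacherSequence μ X)
    (ha : Summable fun k => |a k|) (ha0 : a ≠ 0) : 0 < C μ X a := by
  refine div_pos ?_ (h.variance_G_pos ha ha0)
  rw [lpNorm_four_sq, Real.sqrt_pos]
  obtain ⟨k, hk⟩ := Function.ne_iff.1 ha0
  have hk : a k ≠ 0 := hk
  have h1 := (summable_pow_succ ha (fun _ => abs_nonneg _) 3).le_tsum k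
    fun j _ => by positivity
  have h2 : 0 < |a k| ^ (3 + 1) := by positivity
  exact h2.trans_le h1

/-- Rescaled to unit variance, the coefficients of `F` are normalized, with `κ = C / 16`. -/
lemma IsRademacherSequence.isNormalized (h : IsRademacherSequence μ X)
    (ha : Summable fun k => |a k|) (ha0 : a ≠ 0) :
    IsNormalized (fun k => 1 / (4 * √(variance (G X a) μ)) * a k) (C μ X a / 16) := by
  have hv := h.variance_G_pos ha ha0
  have hC := h.C_pos ha ha0
  set σ := √(variance (G X a) μ) with hσ
  have hσ0 : 0 < σ := Real.sqrt_pos.2 hv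
  have hσ2 : σ ^ 2 = variance (G X a) μ := Real.sq_sqrt hv.le
  refine ⟨?_, ?_, by positivity, ?_⟩
  · simp_rw [abs_mul]
    exact ha.mul_left _
  · have e : ∀ k, (1 / (4 * σ) * a (k - 1) + 1 / (4 * σ) * a k) ^ 2 + (1 / (4 * σ) * a k) ^ 2 =
        1 / (16 * σ ^ 2) * ((a (k - 1) + a k) ^ 2 + a k ^ 2) := fun k => by
      field_simp; ring
    simp_rw [e]
    have h1 := h.variance_G ha
    rw [tsum_mul_left, hσ2, h1]
    have := (variance_terms_pos ha ha0).ne'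
    field_simp
  · have e : ∀ k, |1 / (4 * σ) * a k| ^ 4 = 1 / (256 * (σ ^ 2) ^ 2) * |a k| ^ 4 := fun k => by
      rw [abs_mul, abs_of_pos (by positivity : 0 < 1 / (4 * σ)), mul_pow]
      congr 1
      field_simp; norm_num
    simp_rw [e]
    rw [tsum_mul_left, hσ2, C, lpNorm_four_sq, div_pow, div_pow,
      Real.sq_sqrt (tsum_nonneg fun _ => by positivity)]
    field_simp; norm_num; ring

lemma IsRademacherSequence.measureReal_F (h : IsRademacherSequence μ X)
    (ha : Summable fun k => |a k|) (z : ℝ) :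
    μ.real {ω | z < F μ X a ω} =
      (μ.map (signs X)).real
        {x | z < run (fun k => 1 / (4 * √(variance (G X a) μ)) * a k) x} := by
  have hsm := h.measurable_signs
  have hrm := measurable_run ha
  simp_rw [run_const_mul]
  rw [Measure.real, Measure.real, Measure.map_apply hsm
    (measurableSet_lt measurable_const (hrm.const_mul _))]
  congr 1
  refine measure_congr ?_
  filter_upwards [h.G_ae_eq ha] with ω hω
  have : F μ X a ω = 1 / (4 * √(variance (G X a) μ)) * run a (signs X ω) := by
    rw [F, h.integral_G ha, hω, add_sub_cancel_right, one_div_mul_eq_div, one_div_mul_eq_div,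
      div_div]
  change (z < F μ X a ω) = (z < 1 / (4 * √(variance (G X a) μ)) * run a (signs X ω))
  rw [this]

end Transfer

end TwoRuns

theorem theorem1p1 (a : ℕ → ℤ → ℝ) (ha : ∀ n, Summable (a n)) (ha0 : ∀ n, a n ≠ 0) :
    ∃ K c : ℝ, 0 < K ∧ 0 < c ∧
      ∀ (Ω : Type*) [MeasurableSpace Ω] (μ : Measure Ω) [IsProbabilityMeasure μ]
        (X : ℤ → Ω → ℝ), TwoRuns.IsRademacherSequence μ X →
        ∀ (n : ℕ) (z : ℝ), 0 ≤ z → z ≤ TwoRuns.range μ X (a n) →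
          (1 + z ^ 2) * TwoRuns.gamma μ X (a n) c z ≤ 1 →
          |μ.real {ω | z < TwoRuns.F μ X (a n) ω} / (1 - TwoRuns.Phi z) - 1|
            ≤ K * ((1 + z ^ 2) * TwoRuns.gamma μ X (a n) c z) := by
  -- any `c > 0` works: of the exponential factor in `γ` only the lower bound `1` matters
  refine ⟨TwoRuns.tailConst, 1, TwoRuns.tailConst_pos, one_pos, ?_⟩
  intro Ω _ μ _ X hX n z hz hr hγ
  have han : Summable fun k => |a n k| := (ha n).abs
  have hC := hX.C_pos han (ha0 n)
  have hN := hX.isNormalized han (ha0 n)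
  have := Measure.isProbabilityMeasure_map (μ := μ) hX.measurable_signs.aemeasurable
  have hg := TwoRuns.le_gamma hC.le zero_le_one hz
  have hq := TwoRuns.one_sub_Phi_pos z hz
  have hz3 := TwoRuns.pow_three_mul_C_le hC hz hr
  have hK := TwoRuns.tailConst_pos
  set C := TwoRuns.C μ X (a n)
  set γ := TwoRuns.gamma μ X (a n) 1 z
  have hγ1 : (1 + z ^ 2) * ((1 + z) * C) ≤ (1 + z ^ 2) * γ :=
    mul_le_mul_of_nonneg_left hg (by positivity)
  -- `C ≤ 1` is implicit in the constraint on `γ`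
  have hC1 : C ≤ 1 := by
    have : 0 ≤ z * C + z ^ 2 * ((1 + z) * C) := by positivity
    linarith
  have hmain := hN.abs_tail_sub_le hX.flipInvariant hz (by linarith) (by linarith)
  rw [← hX.measureReal_F han] at hmain
  rw [div_sub_one hq.ne', abs_div, abs_of_pos hq, div_le_iff₀ hq]
  refine hmain.trans ?_
  have h1 : (1 + z) ^ 3 * (C / 16) ≤ (1 + z ^ 2) * γ := by
    have h2 : (1 + z) ^ 2 ≤ 2 * (1 + z ^ 2) := by nlinarith [sq_nonneg (z - 1)]
    have h3 := mul_le_mul_of_nonneg_right h2 (show 0 ≤ (1 + z) * C by positivity)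
    have h4 : 0 ≤ (1 + z ^ 2) * ((1 + z) * C) := by positivity
    linarith
  have h5 := mul_le_mul_of_nonneg_left h1 (mul_pos hK hq).le
  linarith
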